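/- For integers $m,n\ge 2$ and positive smooth functions $\varphi,\phi,\rho$ on $(0,\infty)$ let $$g_{\varphi,\phi,\rho}=dr^2+\varphi(r)^2g_{\mathbb S^m}+\phi(r)^2g_{\mathbb S^n}+\rho(r)^2g_{\mathbb S^2}$$ be the triple warped product metric on $(0,\infty)\times\mathbb S^m\times\mathbb S^n\times\mathbb S^2$, where $g_{\mathbb S^d}$ is the round metric of the unit sphere. **Proposition.** For all integers $m,n\ge 2$ there is a constant $k=k(m,n)>0$, and for all $0<\epsilon<1$ there is a constant $c=c(m,n,\epsilon)>0$, such that for every $L>1$ there are $R=R(m,n,\epsilon,L)>1$, positive numbers $\delta_1,\delta_2,\lambda_1,\lambda_2,\lambda_3$ with $$0<\delta_1<c\,(L^2R^2)^{-1},\qquad 0<\delta_2<c\,L^{-1},$$ and positive smooth functions $\varphi,\phi,\rho$ on $(0,\infty)$ with the following properties: - for $0<r<(2L^2R^3)^{-1}$: $\varphi(r)=kr$, $\phi(r)=kr$, $\rho(r)=\lambda_1$; - for $(2L^2R^2)^{-1}\le r\le(2LR^2)^{-1}$: $\varphi(r)=\delta_1$, $\phi(r)=(1-\epsilon)r$,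 $\rho(r)=\lambda_1$; - for $(2LR)^{-1}\le r\le(LR)^{-1}$: $\varphi(r)=kr$, $\phi(r)=kr$, $\rho(r)=\lambda_2$; - for $L^{-1}\le r\le 1$: $\varphi(r)=(1-\epsilon)r$, $\phi(r)=\delta_2$, $\rho(r)=\lambda_2$; - for $r\ge R$: $\varphi(r)=kr$, $\phi(r)=kr$, $\rho(r)=\lambda_3$; and the Ricci curvature of $g_{\varphi,\phi,\rho}$ is nonnegative on $(0,\infty)\times\mathbb S^m\times\mathbb S^n\times\mathbb S^2$. -/

import Mathlib

open Set Metric Manifold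
open scoped ContDiff

set_option maxSynthPendingDepth 3

noncomputable section

namespace TripleWarped

section Coordinates

variable {E : Type*} [NormedAddCommGroup E] [NormedSpace ℝ E]

/-- The Christoffel symbols of the first kind of a metric `G` written in coordinates on a vector
space: `2 * firstKind G x u v w = (D_u G)(v, w) + (D_v G)(u, w) - (D_w G)(u, v)`. -/
def firstKind (G : E → E →L[ℝ] E →L[ℝ] ℝ) (x : E) : E →L[ℝ] E →L[ℝ] E →L[ℝ] ℝ :=
  let D : E →L[ℝ] E →L[ℝ] E →L[ℝ] ℝ := fderiv ℝ G x
  let T : E →L[ℝ] E →L[ℝ] E →L[ℝ] ℝ :=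
    ((ContinuousLinearMap.flipₗᵢ ℝ E E ℝ).toContinuousLinearEquiv :
      (E →L[ℝ] E →L[ℝ] ℝ) →L[ℝ] (E →L[ℝ] E →L[ℝ] ℝ)).comp D.flip
  (2⁻¹ : ℝ) • (D + D.flip - T)

/-- The Christoffel symbols of the Levi-Civita connection of `G`: the vector `christoffel G x u v`
is characterised by `G x (christoffel G x u v) w = firstKind G x u v w` for all `w`. -/
def christoffel (G : E → E →L[ℝ] E →L[ℝ] ℝ) (x : E) : E →L[ℝ] E →L[ℝ] E :=
  (ContinuousLinearMap.compL ℝ E (E →L[ℝ] ℝ) E (G x).inverse).comp (firstKind G x)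

/-- The endomorphism `u ↦ R(u, v) w`, where `R(u, v) w = ∇_u ∇_v w - ∇_v ∇_u w` for constant
vector fields `u`, `v`, `w` and the Levi-Civita connection `∇` of `G`. -/
def curvatureEnd (G : E → E →L[ℝ] E →L[ℝ] ℝ) (x v w : E) : E →L[ℝ] E :=
  ((fderiv ℝ (christoffel G) x).flip v).flip w - (fderiv ℝ (christoffel G) x v).flip w
    + (christoffel G x).flip (christoffel G x v w)
    - (christoffel G x v).comp ((christoffel G x).flip w)

/-- The Ricci tensor of a metric written in coordinates: the trace of `u ↦ R(u, v) w`. -/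
def ricciCoord (G : E → E →L[ℝ] E →L[ℝ] ℝ) (x v w : E) : ℝ :=
  LinearMap.trace ℝ E (curvatureEnd G x v w : E →ₗ[ℝ] E)

end Coordinates

section Manifolds

variable {E : Type*} [NormedAddCommGroup E] [NormedSpace ℝ E]
  {H : Type*} [TopologicalSpace H] (I : ModelWithCorners ℝ E H)
  {M : Type*} [TopologicalSpace M] [ChartedSpace H M]
  {E' : Type*} [NormedAddCommGroup E'] [NormedSpace ℝ E']
  {H' : Type*} [TopologicalSpace H'] (I' : ModelWithCorners ℝ E' H')
  {M' : Type*} [TopologicalSpace M'] [ChartedSpace H' M']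

/-- Fields of bilinear forms on the tangent spaces of `M`. -/
abbrev FormField (M : Type*) [TopologicalSpace M] [ChartedSpace H M] :=
  (x : M) → TangentSpace I x →L[ℝ] TangentSpace I x →L[ℝ] ℝ

/-- The derivative of `f` at `x`, with the tangent spaces unfolded to the model spaces. -/
def tangentMapAt (f : M → M') (x : M) : E →L[ℝ] E' := mfderiv I I' f x

/-- The pullback `(f^* g)_x (u, v) = g_{f x} (df_x u, df_x v)`. -/
def pullback (f : M → M') (g : FormField I' M') : FormField I M := fun x =>
  ContinuousLinearMap.bilinearComp (E := E') (F := E') (E' := E) (F' := E)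
    (g (f x)) (tangentMapAt I I' f x) (tangentMapAt I I' f x)

/-- The expression of `g` in the coordinates of the preferred chart at `p`. -/
def inChart (g : FormField I M) (p : M) : E → E →L[ℝ] E →L[ℝ] ℝ :=
  pullback 𝓘(ℝ, E) I (extChartAt I p).symm g

/-- The Ricci tensor of the Riemannian metric `g` at `p`, computed in the preferred chart at `p`.
(Mathlib identifies the tangent space at `p` with the model space through this same chart.) -/
def ricci (g : FormField I M) (p : M) (v w : TangentSpace I p) : ℝ :=
  ricciCoord (inChart I g p) (extChartAt I p p) v w

/-- `Ric_g ≥ 0` on the open set `U`. -/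
def RicciNonnegOn (g : FormField I M) (U : Set M) : Prop :=
  ∀ p ∈ U, ∀ v : TangentSpace I p, 0 ≤ ricci I g p v v

end Manifolds

/-- The unit sphere `S^n` in `ℝ^(n+1)`. -/
abbrev Sph (n : ℕ) := sphere (0 : EuclideanSpace ℝ (Fin (n + 1))) 1

/-- The round metric of the unit sphere, induced by the inclusion into Euclidean space. -/
def roundMetric (n : ℕ) : FormField (𝓡 n) (Sph n) :=
  pullback (𝓡 n) 𝓘(ℝ, EuclideanSpace ℝ (Fin (n + 1)))
    (Subtype.val : Sph n → EuclideanSpace ℝ (Fin (n + 1)))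
    (fun _ => innerSL ℝ (E := EuclideanSpace ℝ (Fin (n + 1))))

/-- The manifold `ℝ × S^m × S^n × S^2`; the warped products live on its open subset `r > 0`. -/
abbrev Total (m n : ℕ) := ℝ × Sph m × Sph n × Sph 2

/-- The model with corners of `Total m n`. -/
abbrev totalModel (m n : ℕ) := 𝓘(ℝ, ℝ).prod ((𝓡 m).prod ((𝓡 n).prod (𝓡 2)))

/-- The triple warped product metric
`dr² + φ(r)² g_{S^m} + ψ(r)² g_{S^n} + ρ(r)² g_{S^2}`. -/
def warpedMetric (m n : ℕ) (φ ψ ρ : ℝ → ℝ) : FormField (totalModel m n) (Total m n) := fun p =>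
  pullback (totalModel m n) 𝓘(ℝ, ℝ) (fun q : Total m n => q.1) (fun _ => innerSL ℝ (E := ℝ)) p
    + (φ p.1) ^ 2 • pullback (totalModel m n) (𝓡 m) (fun q : Total m n => q.2.1) (roundMetric m) p
    + (ψ p.1) ^ 2 • pullback (totalModel m n) (𝓡 n) (fun q : Total m n => q.2.2.1) (roundMetric n) p
    + (ρ p.1) ^ 2 • pullback (totalModel m n) (𝓡 2) (fun q : Total m n => q.2.2.2) (roundMetric 2) p

/-- Smooth and positive on `(0, ∞)`. -/
def SmoothPos (f : ℝ → ℝ) : Prop := ContDiffOn ℝ ∞ f (Ioi 0) ∧ ∀ r ∈ Ioi (0 : ℝ), 0 < f r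

end TripleWarped

end

/-!
On a warped product `dr² + φ² g_{S^m} + ψ² g_{S^n} + ρ² g_{S^2}` the Ricci tensor is diagonal
(`ricciCoord_coordMetric`), so that its sign is decided by four inequalities in `r`. Around a point,
the preferred charts of the spheres are stereographic projections from the antipodes, in which the
round metrics are conformal to the flat one (`inChart_roundMetric`); the Christoffel symbols are then
explicit, and their derivatives are needed only at the origin of the chart.

Put `t = log r`, `φ = r e^u`, `ψ = r e^v`, `ρ = l e^w`. The four inequalities turn into conditions on
`u`, `v`, `w` that do not depend on `t` explicitly (`CurvCond`), except for the one along `S^2`, which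
holds when `l` is small (`exists_scale`). In terms of the logarithmic slopes `A = 1 + u'`,
`B = 1 + v'` and `S = w'`, the radial condition reads
`m (A' - A + A²) + n (B' - B + B²) + 2 (S' - S + S²) ≤ 0`.
A cone has `A = B = 1`, `S = 0`, and a constant first sphere means `A = 0`; these states give equality,
but as soon as one slope lies strictly between `0` and `1`, the others may be changed, provided that
it is done slowly. Thus every transition is a succession of elementary moves (`path_ramp`), during
which the radial condition is paid for as follows.

* From the cone to constant `φ` (`exists_reach_split`): `A` decreases to a small `α > 0`, then the
  cone angle of `ψ` is adjusted from `k` to `1 - ε`, and finally `A` decreases to `0`.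
* From constant `φ` back to the cone (`exists_reach_return`): `B` decreases to `1/2`, which is free,
  and stays there until `ψ / r` is small; `S` increases to a small positive value, which then pays
  for the return of `A` and `B` to `1` and for the adjustment of both cone angles to `k`; at last `S`
  returns to `0`, which is free again.

The conditions along `S^m` and `S^n` hold because `k` is small, as long as `φ` and `ψ` are at most
`k r` (`curvCond_of_le`); while `ψ` is larger, it suffices that `A` is small and `ψ < r`. Neither
transition depends on the time spent on the cone, so the two transitions can be given the same
duration `log R`. The second half of the construction is the first one with the roles of the spheres
exchanged (`Path.swap`), and the pieces are glued along the time intervals on which `u`, `v`, `w` are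
affine (`Path.trans`).
-/

namespace TripleWarped

open scoped InnerProductSpace Topology

/-! ### Coordinate formulas for the curvature -/

section General

variable {E : Type*} [NormedAddCommGroup E] [NormedSpace ℝ E]

theorem firstKind_apply (G : E → E →L[ℝ] E →L[ℝ] ℝ) (x u v w : E) :
    firstKind G x u v w =
      2⁻¹ * (fderiv ℝ G x u v w + fderiv ℝ G x v u w - fderiv ℝ G x w u v) := by
  simp [firstKind]

/-- The Christoffel symbol is determined by its defining equation wherever the metric is invertible;
elsewhere `christoffel` would be built from the junk value `0` of the inverse. -/
theorem christoffel_eq_of_forall (G : E → E →L[ℝ] E →L[ℝ] ℝ) {x u v z : E}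
    (e : E ≃L[ℝ] (E →L[ℝ] ℝ)) (he : (e : E →L[ℝ] E →L[ℝ] ℝ) = G x)
    (hz : ∀ w, G x z w = firstKind G x u v w) : christoffel G x u v = z := by
  have h : G x z = firstKind G x u v := ContinuousLinearMap.ext hz
  have h2 : christoffel G x u v = (G x).inverse (firstKind G x u v) := by
    simp [christoffel]
  rw [h2, ← h, ← he, ContinuousLinearMap.inverse_equiv]
  simp

theorem curvatureEnd_apply (G : E → E →L[ℝ] E →L[ℝ] ℝ) (x u v w : E) :
    curvatureEnd G x v w u = fderiv ℝ (christoffel G) x u v w - fderiv ℝ (christoffel G) x v u w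
      + christoffel G x u (christoffel G x v w) - christoffel G x v (christoffel G x u w) := by
  simp [curvatureEnd]

theorem differentiableAt_christoffel [CompleteSpace E] {G : E → E →L[ℝ] E →L[ℝ] ℝ} {x : E}
    (hG : ContDiffAt ℝ 2 G x) (e : E ≃L[ℝ] (E →L[ℝ] ℝ))
    (he : (e : E →L[ℝ] E →L[ℝ] ℝ) = G x) : DifferentiableAt ℝ (christoffel G) x := by
  have hD : DifferentiableAt ℝ (fderiv ℝ G) x :=
    (hG.fderiv_right (m := 1) (by norm_num)).differentiableAt (by norm_num)
  have hF : DifferentiableAt ℝ (firstKind G) x := by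
    unfold firstKind
    have hflip : DifferentiableAt ℝ (fun y => (fderiv ℝ G y).flip) x :=
      (ContinuousLinearMap.flipₗᵢ ℝ E E (E →L[ℝ] ℝ)).toContinuousLinearEquiv.differentiableAt.comp
        x hD
    exact DifferentiableAt.const_smul (R := ℝ)
      ((hD.add hflip).sub ((differentiableAt_const _).clm_comp hflip)) (2⁻¹ : ℝ)
  have hI : DifferentiableAt ℝ (fun y => (G y).inverse) x := by
    have h1 : DifferentiableAt ℝ (ContinuousLinearMap.inverse :
        (E →L[ℝ] (E →L[ℝ] ℝ)) → _) (G x) := by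
      rw [← he]
      exact (contDiffAt_map_inverse (n := 1) e).differentiableAt (by norm_num)
    exact h1.comp x (hG.differentiableAt (by norm_num))
  unfold christoffel
  exact ((ContinuousLinearMap.differentiableAt _).comp x hI).clm_comp hF

/-- Only directional derivatives of one component `Γ` of the Christoffel symbols are needed to
evaluate their derivative. -/
theorem fderiv_christoffel_apply {G : E → E →L[ℝ] E →L[ℝ] ℝ} {x : E}
    (h : DifferentiableAt ℝ (christoffel G) x) (u v w : E) {Γ : E → E} {d : E}
    (hΓ : ∀ᶠ y in 𝓝 x, christoffel G y v w = Γ y)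
    (hd : HasDerivAt (fun t : ℝ => Γ (x + t • u)) d 0) :
    fderiv ℝ (christoffel G) x u v w = d := by
  have h1 : HasFDerivAt (fun y => christoffel G y v w)
      (((fderiv ℝ (christoffel G) x).flip v).flip w) x := by
    simpa using (h.hasFDerivAt.clm_apply (hasFDerivAt_const v x)).clm_apply (hasFDerivAt_const w x)
  have h2 := (h1.congr_of_eventuallyEq (hΓ.mono fun y hy => hy.symm)).hasLineDerivAt u
  exact h2.unique hd

end General

section Trace

variable {M N : Type*} [NormedAddCommGroup M] [NormedSpace ℝ M] [FiniteDimensional ℝ M]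
  [NormedAddCommGroup N] [NormedSpace ℝ N] [FiniteDimensional ℝ N]

theorem trace_prod_eq (L : M × N →ₗ[ℝ] M × N) :
    LinearMap.trace ℝ (M × N) L =
      LinearMap.trace ℝ M (LinearMap.fst ℝ M N ∘ₗ L ∘ₗ LinearMap.inl ℝ M N) +
      LinearMap.trace ℝ N (LinearMap.snd ℝ M N ∘ₗ L ∘ₗ LinearMap.inr ℝ M N) := by
  have h : L = LinearMap.inl ℝ M N ∘ₗ (LinearMap.fst ℝ M N ∘ₗ L) +
      LinearMap.inr ℝ M N ∘ₗ (LinearMap.snd ℝ M N ∘ₗ L) := by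
    ext x <;> simp
  conv_lhs => rw [h]
  rw [map_add, LinearMap.trace_comp_comm' (LinearMap.fst ℝ M N ∘ₗ L) (LinearMap.inl ℝ M N),
    LinearMap.trace_comp_comm' (LinearMap.snd ℝ M N ∘ₗ L) (LinearMap.inr ℝ M N)]
  rfl

/-- The shape of the diagonal blocks of `curvatureEnd` for a warped product. -/
theorem trace_eq_of_forall_apply {F : Type*} [NormedAddCommGroup F] [InnerProductSpace ℝ F]
    [FiniteDimensional ℝ F] (L : F →ₗ[ℝ] F) (α β : ℝ) (p : F)
    (h : ∀ u, L u = α • u + (β * ⟪p, u⟫_ℝ) • p) :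
    LinearMap.trace ℝ F L = α * Module.finrank ℝ F + β * ⟪p, p⟫_ℝ := by
  have : L = α • LinearMap.id + β • ((innerSL ℝ p : F →ₗ[ℝ] ℝ).smulRight p) := by
    ext u
    simp [h, mul_smul]
  rw [this, map_add, map_smul, map_smul, LinearMap.trace_id, LinearMap.trace_smulRight]
  simp

end Trace

/-! ### The metric in stereographic coordinates -/

section Factor

variable {F : Type*} [NormedAddCommGroup F]

/-- The conformal factor of the round metric in stereographic coordinates. -/
noncomputable def stereoFactor (x : F) : ℝ := 4 * (‖x‖ ^ 2 + 4)⁻¹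

theorem stereoFactor_pos (x : F) : 0 < stereoFactor x := by
  unfold stereoFactor; positivity

@[simp] theorem stereoFactor_zero : stereoFactor (0 : F) = 1 := by
  simp [stereoFactor]

variable [InnerProductSpace ℝ F]

theorem contDiff_stereoFactor {n : ℕ∞ω} : ContDiff ℝ n (stereoFactor (F := F)) := by
  unfold stereoFactor
  exact contDiff_const.mul (((contDiff_norm_sq ℝ).add contDiff_const).inv
    fun x => by positivity)

theorem hasDerivAt_stereoFactor_line (x u : F) :
    HasDerivAt (fun t : ℝ => stereoFactor (x + t • u)) (-(stereoFactor x ^ 2 / 2) * ⟪x, u⟫_ℝ) 0 := by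
  have h1 : HasDerivAt (fun t : ℝ => x + t • u) u 0 := by
    simpa using ((hasDerivAt_id (0 : ℝ)).smul_const u).const_add x
  have h2 := ((h1.norm_sq.add_const 4).inv (by positivity)).const_mul 4
  refine h2.congr_deriv ?_
  have h3 : ‖x‖ ^ 2 + 4 ≠ 0 := by positivity
  simp only [stereoFactor, zero_smul, add_zero]
  field_simp
  ring

/-- The component of the Christoffel symbols of `dr² + f(r)² g` along the factor `g`, a round
metric in stereographic coordinates. -/
noncomputable def factorChristoffel (f : ℝ → ℝ) (r : ℝ) (x : F) (a₀ : ℝ) (a : F) (b₀ : ℝ) (b : F) :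
    F :=
  (deriv f r / f r) • (a₀ • b + b₀ • a)
    - (stereoFactor x / 2) • (⟪x, a⟫_ℝ • b + ⟪x, b⟫_ℝ • a - ⟪a, b⟫_ℝ • x)

/-- The contribution of a factor to the radial component of the Christoffel symbols. -/
noncomputable def radialChristoffel (f : ℝ → ℝ) (r : ℝ) (x a b : F) : ℝ :=
  -(f r * deriv f r * stereoFactor x ^ 2 * ⟪a, b⟫_ℝ)

theorem hasDerivAt_warp_line {f : ℝ → ℝ} {r d : ℝ} (hf : HasDerivAt f d r) (u₀ : ℝ) :
    HasDerivAt (fun t : ℝ => f (r + t * u₀)) (d * u₀) 0 := by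
  have h1 : HasDerivAt (fun t : ℝ => r + t * u₀) u₀ 0 := by
    simpa using ((hasDerivAt_id (0 : ℝ)).mul_const u₀).const_add r
  exact HasDerivAt.comp (0 : ℝ) (by simpa using hf) h1

theorem hasDerivAt_factorMetric_line {f : ℝ → ℝ} {r : ℝ} (hf : DifferentiableAt ℝ f r)
    (x u : F) (u₀ : ℝ) (a b : F) :
    HasDerivAt (fun t : ℝ => (f (r + t * u₀) * stereoFactor (x + t • u)) ^ 2 * ⟪a, b⟫_ℝ)
      (2 * (f r * stereoFactor x) * (deriv f r * u₀ * stereoFactor x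
        - f r * (stereoFactor x ^ 2 / 2) * ⟪x, u⟫_ℝ) * ⟪a, b⟫_ℝ) 0 := by
  have h := (((hasDerivAt_warp_line hf.hasDerivAt u₀).mul
    (hasDerivAt_stereoFactor_line x u)).pow 2).mul_const ⟪a, b⟫_ℝ
  refine h.congr_deriv ?_
  simp only [Pi.mul_apply, zero_smul, add_zero, zero_mul, Nat.reduceSub, pow_one,
    Nat.cast_ofNat]
  ring

/-- The defining equation of the Christoffel symbols, restricted to the terms that involve one
factor of the product. -/
theorem factorChristoffel_spec {f : ℝ → ℝ} {r : ℝ} (hf : f r ≠ 0) (x a b w : F) (a₀ b₀ w₀ : ℝ) :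
    (f r * stereoFactor x) ^ 2 * ⟪factorChristoffel f r x a₀ a b₀ b, w⟫_ℝ
        + radialChristoffel f r x a b * w₀
      = 2⁻¹ * (2 * (f r * stereoFactor x) * (deriv f r * a₀ * stereoFactor x
          - f r * (stereoFactor x ^ 2 / 2) * ⟪x, a⟫_ℝ) * ⟪b, w⟫_ℝ
        + 2 * (f r * stereoFactor x) * (deriv f r * b₀ * stereoFactor x
          - f r * (stereoFactor x ^ 2 / 2) * ⟪x, b⟫_ℝ) * ⟪a, w⟫_ℝ
        - 2 * (f r * stereoFactor x) * (deriv f r * w₀ * stereoFactor x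
          - f r * (stereoFactor x ^ 2 / 2) * ⟪x, w⟫_ℝ) * ⟪a, b⟫_ℝ) := by
  simp only [factorChristoffel, radialChristoffel, inner_sub_left, inner_add_left,
    real_inner_smul_left]
  field_simp
  ring

theorem hasDerivAt_factorChristoffel_line {f : ℝ → ℝ} {r : ℝ} (hf : f r ≠ 0)
    (hf1 : DifferentiableAt ℝ f r) (hf2 : DifferentiableAt ℝ (deriv f) r)
    (u₀ a₀ b₀ : ℝ) (u a b : F) :
    HasDerivAt (fun t : ℝ => factorChristoffel f (r + t * u₀) (0 + t • u) a₀ a b₀ b)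
      (((deriv (deriv f) r * f r - deriv f r * deriv f r) / f r ^ 2 * u₀) • (a₀ • b + b₀ • a)
        - (1 / 2 : ℝ) • (⟪u, a⟫_ℝ • b + ⟪u, b⟫_ℝ • a - ⟪a, b⟫_ℝ • u)) 0 := by
  have h1 := (hasDerivAt_warp_line (hf2.hasDerivAt.div hf1.hasDerivAt hf) u₀).smul_const
    (a₀ • b + b₀ • a)
  have h2 : HasDerivAt (fun t : ℝ => t • (⟪u, a⟫_ℝ • b + ⟪u, b⟫_ℝ • a - ⟪a, b⟫_ℝ • u))
      (⟪u, a⟫_ℝ • b + ⟪u, b⟫_ℝ • a - ⟪a, b⟫_ℝ • u) 0 := by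
    simpa using (hasDerivAt_id (0 : ℝ)).smul_const
      (⟪u, a⟫_ℝ • b + ⟪u, b⟫_ℝ • a - ⟪a, b⟫_ℝ • u)
  have h3 := ((hasDerivAt_stereoFactor_line (0 : F) u).div_const 2).smul h2
  refine ((h1.sub h3).congr_deriv ?_).congr_of_eventuallyEq (Filter.Eventually.of_forall ?_)
  · simp
  · intro t
    simp only [factorChristoffel, zero_add, real_inner_smul_left, Pi.div_apply, Pi.sub_apply,
      Pi.smul_apply', smul_sub, smul_add, smul_smul]
    congr 4
    ring_nf

theorem hasDerivAt_radialChristoffel_line {f : ℝ → ℝ} {r : ℝ}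
    (hf1 : DifferentiableAt ℝ f r) (hf2 : DifferentiableAt ℝ (deriv f) r)
    (u₀ : ℝ) (u a b : F) :
    HasDerivAt (fun t : ℝ => radialChristoffel f (r + t * u₀) (0 + t • u) a b)
      (-((deriv f r ^ 2 + f r * deriv (deriv f) r) * u₀ * ⟪a, b⟫_ℝ)) 0 := by
  have h1 := hasDerivAt_warp_line (hf1.hasDerivAt.mul hf2.hasDerivAt) u₀
  have h2 := ((h1.mul ((hasDerivAt_stereoFactor_line (0 : F) u).pow 2)).mul_const ⟪a, b⟫_ℝ).neg
  refine h2.congr_deriv ?_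
  simp
  ring_nf
  simp

end Factor

section Coordinates

variable {A B C : Type*} [NormedAddCommGroup A] [InnerProductSpace ℝ A]
  [NormedAddCommGroup B] [InnerProductSpace ℝ B] [NormedAddCommGroup C] [InnerProductSpace ℝ C]

/-- The inner product pulled back by a linear map `P`. -/
noncomputable def innerForm {E F : Type*} [NormedAddCommGroup E] [NormedSpace ℝ E]
    [NormedAddCommGroup F] [InnerProductSpace ℝ F] (P : E →L[ℝ] F) : E →L[ℝ] E →L[ℝ] ℝ :=
  (innerSL ℝ (E := F)).bilinearComp P P

/-- The triple warped product metric with each sphere in stereographic coordinates. -/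
noncomputable def coordMetric (f g h : ℝ → ℝ) (y : ℝ × A × B × C) :
    (ℝ × A × B × C) →L[ℝ] (ℝ × A × B × C) →L[ℝ] ℝ :=
  innerForm (ContinuousLinearMap.fst ℝ ℝ (A × B × C))
    + (f y.1 * stereoFactor y.2.1) ^ 2 • innerForm ((ContinuousLinearMap.fst ℝ A (B × C)).comp
        (ContinuousLinearMap.snd ℝ ℝ (A × B × C)))
    + (g y.1 * stereoFactor y.2.2.1) ^ 2 • innerForm ((ContinuousLinearMap.fst ℝ B C).comp
        ((ContinuousLinearMap.snd ℝ A (B × C)).comp (ContinuousLinearMap.snd ℝ ℝ (A × B × C))))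
    + (h y.1 * stereoFactor y.2.2.2) ^ 2 • innerForm ((ContinuousLinearMap.snd ℝ B C).comp
        ((ContinuousLinearMap.snd ℝ A (B × C)).comp (ContinuousLinearMap.snd ℝ ℝ (A × B × C))))

theorem coordMetric_apply (f g h : ℝ → ℝ) (y a b : ℝ × A × B × C) :
    coordMetric f g h y a b = a.1 * b.1
      + (f y.1 * stereoFactor y.2.1) ^ 2 * ⟪a.2.1, b.2.1⟫_ℝ
      + (g y.1 * stereoFactor y.2.2.1) ^ 2 * ⟪a.2.2.1, b.2.2.1⟫_ℝ
      + (h y.1 * stereoFactor y.2.2.2) ^ 2 * ⟪a.2.2.2, b.2.2.2⟫_ℝ := by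
  simp [coordMetric, innerForm]
  ring

variable {f g h : ℝ → ℝ}

theorem SmoothPos.contDiffAt (hf : SmoothPos f) {r : ℝ} (hr : 0 < r) {n : ℕ} :
    ContDiffAt ℝ n f r :=
  (hf.1.contDiffAt (Ioi_mem_nhds hr)).of_le (by exact_mod_cast le_top)

theorem SmoothPos.differentiableAt (hf : SmoothPos f) {r : ℝ} (hr : 0 < r) :
    DifferentiableAt ℝ f r :=
  (hf.contDiffAt hr (n := 1)).differentiableAt (by norm_num)

theorem SmoothPos.differentiableAt_deriv (hf : SmoothPos f) {r : ℝ} (hr : 0 < r) :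
    DifferentiableAt ℝ (deriv f) r := by
  have h1 : ContDiffAt ℝ 2 f r := hf.contDiffAt hr (n := 2)
  have h2 : DifferentiableAt ℝ (fderiv ℝ f) r :=
    (h1.fderiv_right (m := 1) (by norm_num)).differentiableAt (by norm_num)
  have : deriv f = fun x => fderiv ℝ f x 1 := by ext x; simp
  rw [this]
  exact h2.clm_apply (differentiableAt_const _)

theorem SmoothPos.contDiffAt_smul (hf : SmoothPos f) {E F : Type*} [NormedAddCommGroup E]
    [NormedSpace ℝ E] [NormedAddCommGroup F] [InnerProductSpace ℝ F] (π : E →L[ℝ] ℝ)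
    (P : E →L[ℝ] F) (T : E →L[ℝ] E →L[ℝ] ℝ) {y : E} (hy : 0 < π y) :
    ContDiffAt ℝ 2 (fun y : E => (f (π y) * stereoFactor (P y)) ^ 2 • T) y := by
  have h1 : ContDiffAt ℝ 2 (fun y : E => f (π y)) y :=
    ContDiffAt.comp y (hf.contDiffAt hy (n := 2)) π.contDiff.contDiffAt
  have h2 : ContDiffAt ℝ 2 (fun y : E => stereoFactor (P y)) y :=
    (contDiff_stereoFactor.comp P.contDiff).contDiffAt
  exact ((h1.mul h2).pow 2).smul contDiffAt_const

theorem SmoothPos.factor_pos (hf : SmoothPos f) {F : Type*} [NormedAddCommGroup F]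
    [InnerProductSpace ℝ F] {r : ℝ} (hr : 0 < r) (x : F) : 0 < (f r * stereoFactor x) ^ 2 :=
  pow_pos (mul_pos (hf.2 _ hr) (stereoFactor_pos x)) 2

theorem contDiffAt_coordMetric (hf : SmoothPos f) (hg : SmoothPos g) (hh : SmoothPos h)
    {y : ℝ × A × B × C} (hy : 0 < y.1) : ContDiffAt ℝ 2 (coordMetric f g h) y := by
  unfold coordMetric
  refine ((contDiffAt_const.add ?_).add ?_).add ?_
  · exact hf.contDiffAt_smul (ContinuousLinearMap.fst ℝ ℝ (A × B × C)) ((ContinuousLinearMap.fst ℝ A (B × C)).comp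
        (ContinuousLinearMap.snd ℝ ℝ (A × B × C))) _ hy
  · exact hg.contDiffAt_smul (ContinuousLinearMap.fst ℝ ℝ (A × B × C)) ((ContinuousLinearMap.fst ℝ B C).comp
        ((ContinuousLinearMap.snd ℝ A (B × C)).comp (ContinuousLinearMap.snd ℝ ℝ (A × B × C)))) _ hy
  · exact hh.contDiffAt_smul (ContinuousLinearMap.fst ℝ ℝ (A × B × C)) ((ContinuousLinearMap.snd ℝ B C).comp
        ((ContinuousLinearMap.snd ℝ A (B × C)).comp (ContinuousLinearMap.snd ℝ ℝ (A × B × C)))) _ hy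

theorem coordMetric_self_eq_zero (hf : SmoothPos f) (hg : SmoothPos g) (hh : SmoothPos h)
    {y a : ℝ × A × B × C} (hy : 0 < y.1) (ha : coordMetric f g h y a a = 0) : a = 0 := by
  obtain ⟨a₀, a₁, a₂, a₃⟩ := a
  have p1 := hf.factor_pos hy y.2.1
  have p2 := hg.factor_pos hy y.2.2.1
  have p3 := hh.factor_pos hy y.2.2.2
  rw [coordMetric_apply] at ha
  simp only [real_inner_self_eq_norm_sq] at ha
  have q0 := mul_self_nonneg a₀
  have q1 := mul_nonneg p1.le (sq_nonneg ‖a₁‖)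
  have q2 := mul_nonneg p2.le (sq_nonneg ‖a₂‖)
  have q3 := mul_nonneg p3.le (sq_nonneg ‖a₃‖)
  have z0 : a₀ * a₀ = 0 := by linarith
  have z1 : (f y.1 * stereoFactor y.2.1) ^ 2 * ‖a₁‖ ^ 2 = 0 := by linarith
  have z2 : (g y.1 * stereoFactor y.2.2.1) ^ 2 * ‖a₂‖ ^ 2 = 0 := by linarith
  have z3 : (h y.1 * stereoFactor y.2.2.2) ^ 2 * ‖a₃‖ ^ 2 = 0 := by linarith
  rw [mul_eq_zero_iff_left p1.ne'] at z1
  rw [mul_eq_zero_iff_left p2.ne'] at z2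
  rw [mul_eq_zero_iff_left p3.ne'] at z3
  simp at z0 z1 z2 z3
  simp [z0, z1, z2, z3]

variable [FiniteDimensional ℝ A] [FiniteDimensional ℝ B] [FiniteDimensional ℝ C]

theorem exists_equiv_coordMetric (hf : SmoothPos f) (hg : SmoothPos g) (hh : SmoothPos h)
    {y : ℝ × A × B × C} (hy : 0 < y.1) :
    ∃ e : (ℝ × A × B × C) ≃L[ℝ] ((ℝ × A × B × C) →L[ℝ] ℝ),
      (e : (ℝ × A × B × C) →L[ℝ] (ℝ × A × B × C) →L[ℝ] ℝ) = coordMetric f g h y := by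
  have hinj : Function.Injective (coordMetric f g h y).toLinearMap := by
    rw [← LinearMap.ker_eq_bot, LinearMap.ker_eq_bot']
    intro a ha
    refine coordMetric_self_eq_zero hf hg hh hy (a := a) ?_
    have : coordMetric f g h y a = 0 := ha
    rw [this]; rfl
  have hdim : Module.finrank ℝ (ℝ × A × B × C) =
      Module.finrank ℝ ((ℝ × A × B × C) →L[ℝ] ℝ) := by
    rw [← (LinearMap.toContinuousLinearMap (𝕜 := ℝ) (E := ℝ × A × B × C) (F' := ℝ)).finrank_eq]
    exact (Subspace.dual_finrank_eq).symm
  refine ⟨(LinearEquiv.ofInjectiveOfFinrankEq _ hinj hdim).toContinuousLinearEquiv, ?_⟩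
  exact ContinuousLinearMap.ext fun a => rfl

end Coordinates

/-! ### The Ricci tensor in stereographic coordinates -/

section Coordinates

variable {A B C : Type*} [NormedAddCommGroup A] [InnerProductSpace ℝ A]
  [NormedAddCommGroup B] [InnerProductSpace ℝ B] [NormedAddCommGroup C] [InnerProductSpace ℝ C]

/-- The Christoffel symbols of `coordMetric`. -/
noncomputable def coordChristoffel (f g h : ℝ → ℝ) (y a b : ℝ × A × B × C) : ℝ × A × B × C :=
  (radialChristoffel f y.1 y.2.1 a.2.1 b.2.1 + radialChristoffel g y.1 y.2.2.1 a.2.2.1 b.2.2.1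
      + radialChristoffel h y.1 y.2.2.2 a.2.2.2 b.2.2.2,
    factorChristoffel f y.1 y.2.1 a.1 a.2.1 b.1 b.2.1,
    factorChristoffel g y.1 y.2.2.1 a.1 a.2.2.1 b.1 b.2.2.1,
    factorChristoffel h y.1 y.2.2.2 a.1 a.2.2.2 b.1 b.2.2.2)

variable {f g h : ℝ → ℝ}

theorem fderiv_coordMetric_apply (hf : SmoothPos f) (hg : SmoothPos g) (hh : SmoothPos h)
    {y : ℝ × A × B × C} (hy : 0 < y.1) (u a b : ℝ × A × B × C) :
    fderiv ℝ (coordMetric f g h) y u a b =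
      2 * (f y.1 * stereoFactor y.2.1) * (deriv f y.1 * u.1 * stereoFactor y.2.1
        - f y.1 * (stereoFactor y.2.1 ^ 2 / 2) * ⟪y.2.1, u.2.1⟫_ℝ) * ⟪a.2.1, b.2.1⟫_ℝ
      + 2 * (g y.1 * stereoFactor y.2.2.1) * (deriv g y.1 * u.1 * stereoFactor y.2.2.1
        - g y.1 * (stereoFactor y.2.2.1 ^ 2 / 2) * ⟪y.2.2.1, u.2.2.1⟫_ℝ) * ⟪a.2.2.1, b.2.2.1⟫_ℝ
      + 2 * (h y.1 * stereoFactor y.2.2.2) * (deriv h y.1 * u.1 * stereoFactor y.2.2.2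
        - h y.1 * (stereoFactor y.2.2.2 ^ 2 / 2) * ⟪y.2.2.2, u.2.2.2⟫_ℝ)
        * ⟪a.2.2.2, b.2.2.2⟫_ℝ := by
  have hd : DifferentiableAt ℝ (coordMetric (A := A) (B := B) (C := C) f g h) y :=
    (contDiffAt_coordMetric hf hg hh hy).differentiableAt (by norm_num)
  have h1 : HasFDerivAt (fun y => coordMetric f g h y a b)
      (((fderiv ℝ (coordMetric f g h) y).flip a).flip b) y := by
    simpa using (hd.hasFDerivAt.clm_apply (hasFDerivAt_const a y)).clm_apply (hasFDerivAt_const b y)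
  have h2 : HasDerivAt (fun t : ℝ => coordMetric f g h (y + t • u) a b)
      (fderiv ℝ (coordMetric f g h) y u a b) 0 := h1.hasLineDerivAt u
  refine h2.unique ?_
  have e1 := hasDerivAt_factorMetric_line (hf.differentiableAt hy) y.2.1 u.2.1 u.1 a.2.1 b.2.1
  have e2 := hasDerivAt_factorMetric_line (hg.differentiableAt hy) y.2.2.1 u.2.2.1 u.1
    a.2.2.1 b.2.2.1
  have e3 := hasDerivAt_factorMetric_line (hh.differentiableAt hy) y.2.2.2 u.2.2.2 u.1
    a.2.2.2 b.2.2.2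
  refine (((e1.const_add (a.1 * b.1)).add e2).add e3).congr_of_eventuallyEq
    (Filter.Eventually.of_forall fun t => ?_)
  simp [coordMetric_apply]

variable [FiniteDimensional ℝ A] [FiniteDimensional ℝ B] [FiniteDimensional ℝ C]

theorem christoffel_coordMetric (hf : SmoothPos f) (hg : SmoothPos g) (hh : SmoothPos h)
    {y : ℝ × A × B × C} (hy : 0 < y.1) (a b : ℝ × A × B × C) :
    christoffel (coordMetric f g h) y a b = coordChristoffel f g h y a b := by
  obtain ⟨e, he⟩ := exists_equiv_coordMetric (A := A) (B := B) (C := C) hf hg hh hy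
  refine christoffel_eq_of_forall _ e he fun w => ?_
  rw [firstKind_apply, fderiv_coordMetric_apply hf hg hh hy, fderiv_coordMetric_apply hf hg hh hy,
    fderiv_coordMetric_apply hf hg hh hy, coordMetric_apply]
  have e1 := factorChristoffel_spec (hf.2 _ hy).ne' y.2.1 a.2.1 b.2.1 w.2.1 a.1 b.1 w.1
  have e2 := factorChristoffel_spec (hg.2 _ hy).ne' y.2.2.1 a.2.2.1 b.2.2.1 w.2.2.1 a.1 b.1 w.1
  have e3 := factorChristoffel_spec (hh.2 _ hy).ne' y.2.2.2 a.2.2.2 b.2.2.2 w.2.2.2 a.1 b.1 w.1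
  simp only [coordChristoffel]
  linear_combination e1 + e2 + e3

/-- The derivative of `f' / f`. -/
noncomputable def logDeriv₂ (f : ℝ → ℝ) (r : ℝ) : ℝ :=
  (deriv (deriv f) r * f r - deriv f r * deriv f r) / f r ^ 2

/-- The derivative at the origin of the chart of `coordChristoffel`, in the direction `u`. -/
noncomputable def coordChristoffelDeriv (f g h : ℝ → ℝ) (r : ℝ) (u a b : ℝ × A × B × C) :
    ℝ × A × B × C :=
  (-((deriv f r ^ 2 + f r * deriv (deriv f) r) * u.1 * ⟪a.2.1, b.2.1⟫_ℝ)
      + -((deriv g r ^ 2 + g r * deriv (deriv g) r) * u.1 * ⟪a.2.2.1, b.2.2.1⟫_ℝ)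
      + -((deriv h r ^ 2 + h r * deriv (deriv h) r) * u.1 * ⟪a.2.2.2, b.2.2.2⟫_ℝ),
    (logDeriv₂ f r * u.1) • (a.1 • b.2.1 + b.1 • a.2.1)
      - (1 / 2 : ℝ) • (⟪u.2.1, a.2.1⟫_ℝ • b.2.1 + ⟪u.2.1, b.2.1⟫_ℝ • a.2.1
        - ⟪a.2.1, b.2.1⟫_ℝ • u.2.1),
    (logDeriv₂ g r * u.1) • (a.1 • b.2.2.1 + b.1 • a.2.2.1)
      - (1 / 2 : ℝ) • (⟪u.2.2.1, a.2.2.1⟫_ℝ • b.2.2.1 + ⟪u.2.2.1, b.2.2.1⟫_ℝ • a.2.2.1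
        - ⟪a.2.2.1, b.2.2.1⟫_ℝ • u.2.2.1),
    (logDeriv₂ h r * u.1) • (a.1 • b.2.2.2 + b.1 • a.2.2.2)
      - (1 / 2 : ℝ) • (⟪u.2.2.2, a.2.2.2⟫_ℝ • b.2.2.2 + ⟪u.2.2.2, b.2.2.2⟫_ℝ • a.2.2.2
        - ⟪a.2.2.2, b.2.2.2⟫_ℝ • u.2.2.2))

theorem fderiv_christoffel_coordMetric (hf : SmoothPos f) (hg : SmoothPos g) (hh : SmoothPos h)
    {r : ℝ} (hr : 0 < r) (u a b : ℝ × A × B × C) :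
    fderiv ℝ (christoffel (coordMetric f g h)) (r, 0) u a b
      = coordChristoffelDeriv f g h r u a b := by
  obtain ⟨e, he⟩ := exists_equiv_coordMetric (A := A) (B := B) (C := C) (y := (r, 0)) hf hg hh hr
  refine fderiv_christoffel_apply
    (differentiableAt_christoffel (contDiffAt_coordMetric hf hg hh hr) e he) u a b
    (Γ := fun y => coordChristoffel f g h y a b) ?_ ?_
  · have : ∀ᶠ y : ℝ × A × B × C in 𝓝 (r, 0), 0 < y.1 :=
      continuous_fst.continuousAt.eventually (Ioi_mem_nhds hr)
    exact this.mono fun y hy => christoffel_coordMetric hf hg hh hy a b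
  · have R : ∀ {k : ℝ → ℝ} (_ : SmoothPos k), DifferentiableAt ℝ k r ∧
        DifferentiableAt ℝ (deriv k) r := fun hk =>
      ⟨hk.differentiableAt hr, hk.differentiableAt_deriv hr⟩
    have d1 := hasDerivAt_radialChristoffel_line (R hf).1 (R hf).2 u.1 u.2.1 a.2.1 b.2.1
    have d2 := hasDerivAt_radialChristoffel_line (R hg).1 (R hg).2 u.1 u.2.2.1 a.2.2.1 b.2.2.1
    have d3 := hasDerivAt_radialChristoffel_line (R hh).1 (R hh).2 u.1 u.2.2.2 a.2.2.2 b.2.2.2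
    have e1 := hasDerivAt_factorChristoffel_line (hf.2 r hr).ne' (R hf).1 (R hf).2 u.1 a.1 b.1
      u.2.1 a.2.1 b.2.1
    have e2 := hasDerivAt_factorChristoffel_line (hg.2 r hr).ne' (R hg).1 (R hg).2 u.1 a.1 b.1
      u.2.2.1 a.2.2.1 b.2.2.1
    have e3 := hasDerivAt_factorChristoffel_line (hh.2 r hr).ne' (R hh).1 (R hh).2 u.1 a.1 b.1
      u.2.2.2 a.2.2.2 b.2.2.2
    exact ((d1.add d2).add d3).prodMk (e1.prodMk (e2.prodMk e3))

/-- The coefficient of the Ricci tensor on a factor of dimension `d`, for `p`, `p'`, `p''` the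
warping function and its derivatives and `s` the sum of the terms `dᵢ fᵢ' / fᵢ` of the other
factors. -/
def factorRicci (d p p' p'' s : ℝ) : ℝ :=
  (d - 1) * (1 - p' ^ 2) - p * p'' - p * p' * s

/-- The trace of the diagonal block of `u ↦ R(u, v) v` on a factor; `s` collects the radial terms
of the other factors. -/
theorem trace_curvature_factor {F : Type*} [NormedAddCommGroup F] [InnerProductSpace ℝ F]
    [FiniteDimensional ℝ F] (L : F →ₗ[ℝ] F) (f : ℝ → ℝ) (r v₀ s : ℝ) (v : F) (hf : f r ≠ 0)
    (h : ∀ u, L u =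
      -((1 / 2 : ℝ) • (⟪u, v⟫_ℝ • v + ⟪u, v⟫_ℝ • v - ⟪v, v⟫_ℝ • u))
      - ((logDeriv₂ f r * v₀) • (v₀ • u) - (1 / 2 : ℝ) • (⟪v, u⟫_ℝ • v + ⟪v, v⟫_ℝ • u
        - ⟪u, v⟫_ℝ • v))
      + (deriv f r / f r) • ((-(f r * deriv f r * ⟪v, v⟫_ℝ) - s) • u)
      - (deriv f r / f r) • (v₀ • (deriv f r / f r) • (v₀ • u)
          + (-(f r * deriv f r * ⟪u, v⟫_ℝ)) • v)) :
    LinearMap.trace ℝ F L = (Module.finrank ℝ F - 1) * (1 - deriv f r ^ 2) * ‖v‖ ^ 2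
      - Module.finrank ℝ F * (deriv (deriv f) r / f r) * v₀ ^ 2
      - Module.finrank ℝ F * (deriv f r / f r) * s := by
  rw [trace_eq_of_forall_apply L (⟪v, v⟫_ℝ - logDeriv₂ f r * v₀ ^ 2
    + (deriv f r / f r) * (-(f r * deriv f r * ⟪v, v⟫_ℝ) - s) - (deriv f r / f r) ^ 2 * v₀ ^ 2)
    (-1 + deriv f r ^ 2) v]
  · rw [real_inner_self_eq_norm_sq, logDeriv₂]
    field_simp
    ring
  · intro u
    rw [h u, real_inner_comm v u]
    have : deriv f r / f r * (f r * deriv f r * ⟪v, u⟫_ℝ) = deriv f r ^ 2 * ⟪v, u⟫_ℝ := by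
      field_simp
    rw [smul_add, smul_smul _ _ v, mul_neg, this]
    module

/-- The Ricci tensor of the triple warped product is diagonal. -/
theorem ricciCoord_coordMetric (hf : SmoothPos f) (hg : SmoothPos g) (hh : SmoothPos h)
    {r : ℝ} (hr : 0 < r) (v : ℝ × A × B × C) {a b c : ℝ} (ha : a = Module.finrank ℝ A)
    (hb : b = Module.finrank ℝ B) (hc : c = Module.finrank ℝ C) :
    ricciCoord (coordMetric f g h) (r, 0) v v =
      -(a * (deriv (deriv f) r / f r) + b * (deriv (deriv g) r / g r)
          + c * (deriv (deriv h) r / h r)) * v.1 ^ 2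
      + factorRicci a (f r) (deriv f r) (deriv (deriv f) r)
          (b * (deriv g r / g r) + c * (deriv h r / h r)) * ‖v.2.1‖ ^ 2
      + factorRicci b (g r) (deriv g r) (deriv (deriv g) r)
          (a * (deriv f r / f r) + c * (deriv h r / h r)) * ‖v.2.2.1‖ ^ 2
      + factorRicci c (h r) (deriv h r) (deriv (deriv h) r)
          (a * (deriv f r / f r) + b * (deriv g r / g r)) * ‖v.2.2.2‖ ^ 2 := by
  have hf0 := (hf.2 r hr).ne'
  have hg0 := (hg.2 r hr).ne'
  have hh0 := (hh.2 r hr).ne'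
  have hchr : ∀ a b : ℝ × A × B × C, christoffel (coordMetric f g h) (r, 0) a b =
      coordChristoffel f g h (r, 0) a b := christoffel_coordMetric hf hg hh hr
  obtain ⟨v₀, v₁, v₂, v₃⟩ := v
  rw [ricciCoord, trace_prod_eq, trace_prod_eq (M := A), trace_prod_eq (M := B)]
  rw [trace_eq_of_forall_apply _ (-(f r * deriv (deriv f) r * ‖v₁‖ ^ 2
      + g r * deriv (deriv g) r * ‖v₂‖ ^ 2 + h r * deriv (deriv h) r * ‖v₃‖ ^ 2)) 0 0,
    trace_curvature_factor _ f r v₀ (g r * deriv g r * ‖v₂‖ ^ 2 + h r * deriv h r * ‖v₃‖ ^ 2) v₁ hf0,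
    trace_curvature_factor _ g r v₀ (f r * deriv f r * ‖v₁‖ ^ 2 + h r * deriv h r * ‖v₃‖ ^ 2) v₂ hg0,
    trace_curvature_factor _ h r v₀ (f r * deriv f r * ‖v₁‖ ^ 2 + g r * deriv g r * ‖v₂‖ ^ 2) v₃ hh0]
  · simp only [factorRicci, ← ha, ← hb, ← hc, Module.finrank_self]
    field_simp
    push_cast
    ring
  all_goals
    intro u
    simp [curvatureEnd_apply, fderiv_christoffel_coordMetric hf hg hh hr, hchr,
      coordChristoffelDeriv, coordChristoffel, factorChristoffel, radialChristoffel]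
  iterate 3
    · congr 2
      ring
  simp only [real_inner_smul_right, real_inner_self_eq_norm_sq]
  field_simp
  ring

end Coordinates

/-! ### Pullbacks and the charts of the spheres -/

section Pullback

variable {E : Type*} [NormedAddCommGroup E] [NormedSpace ℝ E]
  {H : Type*} [TopologicalSpace H] {I : ModelWithCorners ℝ E H}
  {M : Type*} [TopologicalSpace M] [ChartedSpace H M]
  {E' : Type*} [NormedAddCommGroup E'] [NormedSpace ℝ E']
  {H' : Type*} [TopologicalSpace H'] {I' : ModelWithCorners ℝ E' H'}
  {M' : Type*} [TopologicalSpace M'] [ChartedSpace H' M']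
  {E'' : Type*} [NormedAddCommGroup E''] [NormedSpace ℝ E'']
  {H'' : Type*} [TopologicalSpace H''] {I'' : ModelWithCorners ℝ E'' H''}
  {M'' : Type*} [TopologicalSpace M''] [ChartedSpace H'' M'']

theorem tangentMapAt_comp {g : M' → M''} {f : M → M'} {x : M}
    (hg : MDifferentiableAt I' I'' g (f x)) (hf : MDifferentiableAt I I' f x) :
    tangentMapAt I I'' (g ∘ f) x = (tangentMapAt I' I'' g (f x)).comp (tangentMapAt I I' f x) :=
  mfderiv_comp x hg hf

theorem pullback_apply (f : M → M') (g : FormField I' M') (x : M) (u v : E) :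
    (pullback I I' f g x : E →L[ℝ] E →L[ℝ] ℝ) u v =
      (g (f x) : E' →L[ℝ] E' →L[ℝ] ℝ) (tangentMapAt I I' f x u) (tangentMapAt I I' f x v) := rfl

theorem pullback_pullback_apply {g : M' → M''} {f : M → M'} {x : M} (G : FormField I'' M'')
    (hg : MDifferentiableAt I' I'' g (f x)) (hf : MDifferentiableAt I I' f x) (u v : E) :
    (pullback I' I'' g G (f x) : E' →L[ℝ] E' →L[ℝ] ℝ)
        (tangentMapAt I I' f x u) (tangentMapAt I I' f x v)
      = (pullback I I'' (g ∘ f) G x : E →L[ℝ] E →L[ℝ] ℝ) u v := by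
  rw [pullback_apply, pullback_apply, tangentMapAt_comp hg hf]
  rfl

theorem mdifferentiableAt_chart_symm [IsManifold I 1 M] (hI : range I = univ) (p : M)
    (hp : (extChartAt I p).target = univ) (y : E) :
    MDifferentiableAt 𝓘(ℝ, E) I (extChartAt I p).symm y := by
  have h := mdifferentiableWithinAt_extChartAt_symm (I := I) (x := p) (z := y)
    (by rw [hp]; trivial)
  rwa [hI, mdifferentiableWithinAt_univ] at h

end Pullback

section Sphere

variable {d : ℕ}

theorem sph_target (p : Sph d) : (extChartAt (𝓡 d) p).target = univ := by
  have := Fact.mk (@finrank_euclideanSpace_fin ℝ _ (d + 1))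
  have h : chartAt (EuclideanSpace ℝ (Fin d)) p = stereographic' d (-p) := rfl
  simp [extChartAt, h]

theorem sph_center (p : Sph d) : extChartAt (𝓡 d) p p = 0 := by
  have := Fact.mk (@finrank_euclideanSpace_fin ℝ _ (d + 1))
  have h : chartAt (EuclideanSpace ℝ (Fin d)) p = stereographic' d (-p) := rfl
  have h' : extChartAt (𝓡 d) p p = (OrthonormalBasis.fromOrthogonalSpanSingleton (𝕜 := ℝ) d
      (ne_zero_of_mem_unit_sphere (-p))).repr
        (stereographic (norm_eq_of_mem_sphere (-p)) p) := rfl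
  rw [h', stereographic_neg_apply, map_zero]

/-- The inverse of the preferred chart of the sphere is an inverse stereographic projection. -/
theorem coe_comp_sph_chart_symm (p : Sph d) :
    ∃ (U : EuclideanSpace ℝ (Fin d) →ₗᵢ[ℝ] EuclideanSpace ℝ (Fin (d + 1)))
      (q : EuclideanSpace ℝ (Fin (d + 1))), ‖q‖ = 1 ∧ (∀ x, ⟪U x, q⟫_ℝ = 0) ∧
      ∀ x, (((extChartAt (𝓡 d) p).symm x : Sph d) : EuclideanSpace ℝ (Fin (d + 1))) =
        (‖x‖ ^ 2 + 4)⁻¹ • ((4 : ℝ) • U x + (‖x‖ ^ 2 - 4) • q) := by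
  have := Fact.mk (@finrank_euclideanSpace_fin ℝ _ (d + 1))
  let V := (OrthonormalBasis.fromOrthogonalSpanSingleton (𝕜 := ℝ) d
    (ne_zero_of_mem_unit_sphere (-p))).repr
  refine ⟨(Submodule.subtypeₗᵢ _).comp V.symm.toLinearIsometry, (-p : Sph d), by simp, ?_, ?_⟩
  · intro x
    exact Submodule.mem_orthogonal_singleton_iff_inner_left.mp (V.symm x).2
  · intro x
    have h : (extChartAt (𝓡 d) p).symm x = (stereographic' d (-p)).symm x := rfl
    rw [h, stereographic'_symm_apply]
    have hn : ‖((V.symm x : _) : EuclideanSpace ℝ (Fin (d + 1)))‖ = ‖x‖ := by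
      rw [← Submodule.coe_norm, LinearIsometryEquiv.norm_map]
    change (‖((V.symm x : _) : EuclideanSpace ℝ (Fin (d + 1)))‖ ^ 2 + 4)⁻¹ • (4 : ℝ) • _
      + (‖((V.symm x : _) : EuclideanSpace ℝ (Fin (d + 1)))‖ ^ 2 + 4)⁻¹ •
        (‖((V.symm x : _) : EuclideanSpace ℝ (Fin (d + 1)))‖ ^ 2 - 4) • _ = _
    rw [hn, ← smul_add]
    rfl

/-- Inverse stereographic projection is conformal. -/
theorem inner_fderiv_stereo {F F' : Type*} [NormedAddCommGroup F] [InnerProductSpace ℝ F]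
    [NormedAddCommGroup F'] [InnerProductSpace ℝ F'] (U : F →ₗᵢ[ℝ] F') (q : F') (hq : ‖q‖ = 1)
    (hU : ∀ x, ⟪U x, q⟫_ℝ = 0) (x : F) {D : F →L[ℝ] F'}
    (hD : HasFDerivAt (fun x => (‖x‖ ^ 2 + 4)⁻¹ • ((4 : ℝ) • U x + (‖x‖ ^ 2 - 4) • q)) D x)
    (a b : F) : ⟪D a, D b⟫_ℝ = stereoFactor x ^ 2 * ⟪a, b⟫_ℝ := by
  have hx : ‖x‖ ^ 2 + 4 ≠ 0 := by positivity
  have key : ∀ u, D u = stereoFactor x • U u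
      + (stereoFactor x ^ 2 * ⟪x, u⟫_ℝ) • ((-(1 / 2 : ℝ)) • U x + q) := by
    intro u
    have h1 : HasDerivAt (fun t : ℝ => x + t • u) u 0 := by
      simpa using ((hasDerivAt_id (0 : ℝ)).smul_const u).const_add x
    have hn := h1.norm_sq
    have hU : HasDerivAt (fun t : ℝ => (4 : ℝ) • U (x + t • u)) ((4 : ℝ) • U u) 0 :=
      (U.toContinuousLinearMap.hasFDerivAt.comp_hasDerivAt (0 : ℝ) h1).const_smul (4 : ℝ)
    have h2 := ((hn.add_const 4).inv (by positivity)).smul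
      (hU.add ((hn.sub_const 4).smul_const q))
    have h3 := hD.hasLineDerivAt u
    refine (HasDerivAt.unique h3 h2).trans ?_
    simp only [zero_smul, add_zero, stereoFactor, Pi.inv_apply, Pi.add_apply]
    match_scalars <;> field_simp <;> ring
  rw [key, key]
  have hq' : ⟪q, q⟫_ℝ = 1 := by rw [real_inner_self_eq_norm_sq, hq]; norm_num
  have hU' : ∀ x, ⟪q, U x⟫_ℝ = 0 := fun x => by rw [real_inner_comm]; exact hU x
  simp only [inner_add_left, inner_add_right, real_inner_smul_left, real_inner_smul_right,
    LinearIsometry.inner_map_map, hU, hU', hq', real_inner_self_eq_norm_sq]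
  rw [real_inner_comm x a, stereoFactor]
  field_simp
  ring

theorem mdifferentiable_coe_sph : MDifferentiable (𝓡 d) 𝓘(ℝ, EuclideanSpace ℝ (Fin (d + 1)))
    (Subtype.val : Sph d → EuclideanSpace ℝ (Fin (d + 1))) := by
  have := Fact.mk (@finrank_euclideanSpace_fin ℝ _ (d + 1))
  exact (contMDiff_coe_sphere (m := 1)).mdifferentiable (by norm_num)

theorem mdifferentiable_sph_chart_symm (p : Sph d) :
    MDifferentiable 𝓘(ℝ, EuclideanSpace ℝ (Fin d)) (𝓡 d) (extChartAt (𝓡 d) p).symm := fun y =>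
  mdifferentiableAt_chart_symm (I := 𝓡 d) (by simp) p (sph_target p) y

theorem hasFDerivAt_coe_chart_symm (p : Sph d) (y : EuclideanSpace ℝ (Fin d)) :
    HasFDerivAt (fun x => ((extChartAt (𝓡 d) p).symm x : EuclideanSpace ℝ (Fin (d + 1))))
      (tangentMapAt 𝓘(ℝ, EuclideanSpace ℝ (Fin d)) 𝓘(ℝ, EuclideanSpace ℝ (Fin (d + 1)))
        (Subtype.val ∘ (extChartAt (𝓡 d) p).symm) y) y := by
  have h3 : MDifferentiableAt 𝓘(ℝ, EuclideanSpace ℝ (Fin d))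
      𝓘(ℝ, EuclideanSpace ℝ (Fin (d + 1))) (Subtype.val ∘ (extChartAt (𝓡 d) p).symm) y :=
    (mdifferentiable_coe_sph _).comp y (mdifferentiable_sph_chart_symm p y)
  rw [tangentMapAt, mfderiv_eq_fderiv]
  exact h3.differentiableAt.hasFDerivAt

end Sphere

/-! ### The warped product metric in the preferred charts -/

section Sphere
variable {d : ℕ}
theorem inChart_roundMetric (p : Sph d) (y a b : EuclideanSpace ℝ (Fin d)) :
    inChart (𝓡 d) (roundMetric d) p y a b = stereoFactor y ^ 2 * ⟪a, b⟫_ℝ := by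
  obtain ⟨U, q, hq, hU, hF⟩ := coe_comp_sph_chart_symm p
  have hD := hasFDerivAt_coe_chart_symm p y
  rw [funext hF] at hD
  rw [← inner_fderiv_stereo U q hq hU y hD a b]
  have := pullback_pullback_apply (fun _ => innerSL ℝ (E := EuclideanSpace ℝ (Fin (d + 1))))
    (mdifferentiable_coe_sph _) (mdifferentiable_sph_chart_symm p y) a b
  refine Eq.trans this ?_
  rfl

end Sphere

section Total

variable {m n : ℕ} {φ ψ ρ : ℝ → ℝ}

theorem total_target (p : Total m n) : (extChartAt (totalModel m n) p).target = univ := by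
  rw [extChartAt_prod, extChartAt_prod, extChartAt_prod]
  simp only [PartialEquiv.prod_target, sph_target, univ_prod_univ]
  have h : (extChartAt 𝓘(ℝ, ℝ) p.1).target = univ := by simp; rfl
  rw [h, univ_prod_univ]

theorem mdifferentiable_total_chart_symm (p : Total m n) :
    MDifferentiable 𝓘(ℝ, ℝ × EuclideanSpace ℝ (Fin m) × EuclideanSpace ℝ (Fin n) ×
      EuclideanSpace ℝ (Fin 2)) (totalModel m n) (extChartAt (totalModel m n) p).symm := fun y =>
  mdifferentiableAt_chart_symm (I := totalModel m n) (by simp) p (total_target p) y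

/-- A factor of the product metric in the product chart is the factor in its own chart. -/
theorem pullback_factor {d : ℕ} {E : Type*} [NormedAddCommGroup E] [NormedSpace ℝ E]
    {H : Type*} [TopologicalSpace H] {I : ModelWithCorners ℝ E H}
    {M : Type*} [TopologicalSpace M] [ChartedSpace H M] {χ : E → M} {π : M → Sph d} (p : Sph d)
    (P : E →L[ℝ] EuclideanSpace ℝ (Fin d)) {y : E} (hχ : MDifferentiableAt 𝓘(ℝ, E) I χ y)
    (hπ : MDifferentiableAt I (𝓡 d) π (χ y)) (h : π ∘ χ = (extChartAt (𝓡 d) p).symm ∘ P) (a b : E) :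
    (pullback I (𝓡 d) π (roundMetric d) (χ y) : E →L[ℝ] E →L[ℝ] ℝ)
        (tangentMapAt 𝓘(ℝ, E) I χ y a) (tangentMapAt 𝓘(ℝ, E) I χ y b)
      = stereoFactor (P y) ^ 2 * ⟪P a, P b⟫_ℝ := by
  rw [pullback_pullback_apply _ hπ hχ, h, ← inChart_roundMetric p]
  have hP : MDifferentiableAt 𝓘(ℝ, E) 𝓘(ℝ, EuclideanSpace ℝ (Fin d)) P y :=
    P.differentiableAt.mdifferentiableAt
  have := pullback_pullback_apply (roundMetric d) (mdifferentiable_sph_chart_symm p (P y)) hP a b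
  rw [← this, tangentMapAt, mfderiv_eq_fderiv, ContinuousLinearMap.fderiv]
  rfl

theorem pullback_line {E : Type*} [NormedAddCommGroup E] [NormedSpace ℝ E]
    {H : Type*} [TopologicalSpace H] {I : ModelWithCorners ℝ E H}
    {M : Type*} [TopologicalSpace M] [ChartedSpace H M] {χ : E → M} {π : M → ℝ}
    (P : E →L[ℝ] ℝ) {y : E} (hχ : MDifferentiableAt 𝓘(ℝ, E) I χ y)
    (hπ : MDifferentiableAt I 𝓘(ℝ, ℝ) π (χ y)) (h : π ∘ χ = P) (a b : E) :
    (pullback I 𝓘(ℝ, ℝ) π (fun _ => innerSL ℝ (E := ℝ)) (χ y) : E →L[ℝ] E →L[ℝ] ℝ)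
        (tangentMapAt 𝓘(ℝ, E) I χ y a) (tangentMapAt 𝓘(ℝ, E) I χ y b)
      = P a * P b := by
  refine (pullback_pullback_apply (fun _ => innerSL ℝ (E := ℝ)) hπ hχ a b).trans ?_
  have hP : tangentMapAt 𝓘(ℝ, E) 𝓘(ℝ, ℝ) P y = P := by
    rw [tangentMapAt, mfderiv_eq_fderiv, ContinuousLinearMap.fderiv]
  rw [h]
  refine (pullback_apply (P : E → ℝ) (fun _ => innerSL ℝ (E := ℝ)) y a b).trans ?_
  rw [hP]
  exact mul_comm (P b) (P a)

theorem inChart_warpedMetric (p : Total m n) :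
    inChart (totalModel m n) (warpedMetric m n φ ψ ρ) p = coordMetric φ ψ ρ := by
  funext y
  have hχ := mdifferentiable_total_chart_symm p y
  have hy : (extChartAt (totalModel m n) p).symm y = (y.1, (extChartAt (𝓡 m) p.2.1).symm y.2.1,
    (extChartAt (𝓡 n) p.2.2.1).symm y.2.2.1, (extChartAt (𝓡 2) p.2.2.2).symm y.2.2.2) := rfl
  have hs : MDifferentiable (totalModel m n) ((𝓡 m).prod ((𝓡 n).prod (𝓡 2)))
    (fun q : Total m n => q.2) := mdifferentiable_snd
  have hss : MDifferentiable (totalModel m n) ((𝓡 n).prod (𝓡 2))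
    (fun q : Total m n => q.2.2) := mdifferentiable_snd.comp hs
  have e0 := pullback_line (I := totalModel m n) (π := fun q : Total m n => q.1)
    (ContinuousLinearMap.fst ℝ ℝ (EuclideanSpace ℝ (Fin m) × EuclideanSpace ℝ (Fin n) ×
      EuclideanSpace ℝ (Fin 2))) hχ (mdifferentiable_fst _) rfl
  have e1 := pullback_factor (I := totalModel m n) (π := fun q : Total m n => q.2.1) p.2.1
    ((ContinuousLinearMap.fst ℝ _ _).comp (ContinuousLinearMap.snd ℝ ℝ
      (EuclideanSpace ℝ (Fin m) × EuclideanSpace ℝ (Fin n) × EuclideanSpace ℝ (Fin 2)))) hχ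
    ((mdifferentiable_fst.comp hs) _) rfl
  have e2 := pullback_factor (I := totalModel m n) (π := fun q : Total m n => q.2.2.1) p.2.2.1
    ((ContinuousLinearMap.fst ℝ _ _).comp ((ContinuousLinearMap.snd ℝ _ _).comp
      (ContinuousLinearMap.snd ℝ ℝ
      (EuclideanSpace ℝ (Fin m) × EuclideanSpace ℝ (Fin n) × EuclideanSpace ℝ (Fin 2))))) hχ
    ((mdifferentiable_fst.comp hss) _) rfl
  have e3 := pullback_factor (I := totalModel m n) (π := fun q : Total m n => q.2.2.2) p.2.2.2
    ((ContinuousLinearMap.snd ℝ _ _).comp ((ContinuousLinearMap.snd ℝ _ _).comp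
      (ContinuousLinearMap.snd ℝ ℝ
      (EuclideanSpace ℝ (Fin m) × EuclideanSpace ℝ (Fin n) × EuclideanSpace ℝ (Fin 2))))) hχ
    ((mdifferentiable_snd.comp hss) _) rfl
  refine ContinuousLinearMap.ext fun a => ContinuousLinearMap.ext fun b => ?_
  rw [coordMetric_apply, mul_pow, mul_pow, mul_pow, mul_assoc, mul_assoc, mul_assoc]
  exact congrArg₂ (· + ·) (congrArg₂ (· + ·) (congrArg₂ (· + ·) (e0 a b)
    (congrArg (φ y.1 ^ 2 * ·) (e1 a b))) (congrArg (ψ y.1 ^ 2 * ·) (e2 a b)))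
    (congrArg (ρ y.1 ^ 2 * ·) (e3 a b))

/-- The Ricci tensor being diagonal, its sign is decided by one inequality for the radial direction
and one for each sphere. -/
theorem ricciNonnegOn_warpedMetric (hφ : SmoothPos φ) (hψ : SmoothPos ψ) (hρ : SmoothPos ρ)
    (h₀ : ∀ r, 0 < r → m * (deriv (deriv φ) r / φ r) + n * (deriv (deriv ψ) r / ψ r)
      + 2 * (deriv (deriv ρ) r / ρ r) ≤ 0)
    (h₁ : ∀ r, 0 < r → 0 ≤ factorRicci m (φ r) (deriv φ r) (deriv (deriv φ) r)
      (n * (deriv ψ r / ψ r) + 2 * (deriv ρ r / ρ r)))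
    (h₂ : ∀ r, 0 < r → 0 ≤ factorRicci n (ψ r) (deriv ψ r) (deriv (deriv ψ) r)
      (m * (deriv φ r / φ r) + 2 * (deriv ρ r / ρ r)))
    (h₃ : ∀ r, 0 < r → 0 ≤ factorRicci 2 (ρ r) (deriv ρ r) (deriv (deriv ρ) r)
      (m * (deriv φ r / φ r) + n * (deriv ψ r / ψ r))) :
    RicciNonnegOn (totalModel m n) (warpedMetric m n φ ψ ρ) {p | 0 < p.1} := by
  intro p hp v
  have hp' : 0 < p.1 := hp
  have hc : extChartAt (totalModel m n) p p = (p.1, 0) := by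
    rw [extChartAt_prod, extChartAt_prod, extChartAt_prod]
    simp only [PartialEquiv.prod_coe, sph_center]
    rfl
  rw [ricci, inChart_warpedMetric, hc]
  have key := ricciCoord_coordMetric (A := EuclideanSpace ℝ (Fin m))
    (B := EuclideanSpace ℝ (Fin n)) (C := EuclideanSpace ℝ (Fin 2)) hφ hψ hρ hp' v
    (a := m) (b := n) (c := 2) (by simp) (by simp) (by simp)
  refine le_of_le_of_eq ?_ key.symm
  have e0 := mul_nonneg (neg_nonneg.2 (h₀ _ hp')) (sq_nonneg v.1)
  have e1 := mul_nonneg (h₁ _ hp') (sq_nonneg ‖v.2.1‖)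
  have e2 := mul_nonneg (h₂ _ hp') (sq_nonneg ‖v.2.2.1‖)
  have e3 := mul_nonneg (h₃ _ hp') (sq_nonneg ‖v.2.2.2‖)
  exact add_nonneg (add_nonneg (add_nonneg e0 e1) e2) e3

end Total

/-! ### Smooth ramps and paths of warping exponents -/

section Step

/-- The primitive of the smooth step function vanishing at `0`. -/
noncomputable def stepInt (y : ℝ) : ℝ := ∫ x in (0 : ℝ)..y, Real.smoothTransition x

theorem hasDerivAt_stepInt (y : ℝ) : HasDerivAt stepInt (Real.smoothTransition y) y :=
  intervalIntegral.integral_hasDerivAt_right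
    (Real.smoothTransition.continuous.intervalIntegrable _ _)
    (Real.smoothTransition.continuous.stronglyMeasurableAtFilter _ _)
    Real.smoothTransition.continuous.continuousAt

theorem contDiff_stepInt : ContDiff ℝ ∞ stepInt := by
  rw [contDiff_infty_iff_deriv]
  have h : deriv stepInt = Real.smoothTransition := funext fun y => (hasDerivAt_stepInt y).deriv
  rw [h]
  exact ⟨fun y => (hasDerivAt_stepInt y).differentiableAt, Real.smoothTransition.contDiff⟩

theorem stepInt_of_nonpos {y : ℝ} (hy : y ≤ 0) : stepInt y = 0 := by
  unfold stepInt
  rw [intervalIntegral.integral_congr (g := fun _ => (0 : ℝ))]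
  · simp
  · intro x hx
    rw [uIcc_of_ge hy] at hx
    exact Real.smoothTransition.zero_of_nonpos hx.2

theorem stepInt_of_one_le {y : ℝ} (hy : 1 ≤ y) : stepInt y = stepInt 1 + (y - 1) := by
  unfold stepInt
  rw [← intervalIntegral.integral_add_adjacent_intervals (b := 1)
    (Real.smoothTransition.continuous.intervalIntegrable _ _)
    (Real.smoothTransition.continuous.intervalIntegrable _ _),
    intervalIntegral.integral_congr (a := 1) (b := y) (g := fun _ => (1 : ℝ))]
  · simp
  · intro x hx
    rw [uIcc_of_le hy] at hx
    exact Real.smoothTransition.one_of_one_le hx.1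

theorem stepInt_nonneg {y : ℝ} (hy : 0 ≤ y) : 0 ≤ stepInt y :=
  intervalIntegral.integral_nonneg hy fun x _ => Real.smoothTransition.nonneg x

theorem stepInt_le {y : ℝ} (hy : 0 ≤ y) : stepInt y ≤ y := by
  have h := intervalIntegral.integral_mono_on (μ := MeasureTheory.volume) hy
    (Real.smoothTransition.continuous.intervalIntegrable 0 y)
    (continuous_const.intervalIntegrable 0 y) fun x _ => Real.smoothTransition.le_one x
  simpa [stepInt] using h

theorem differentiable_smoothTransition : Differentiable ℝ Real.smoothTransition :=
  (Real.smoothTransition.contDiff (n := 1)).differentiable (by norm_num)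

theorem contDiff_deriv_smoothTransition : ContDiff ℝ ∞ (deriv Real.smoothTransition) :=
  (contDiff_infty_iff_deriv.1 Real.smoothTransition.contDiff).2

theorem deriv_smoothTransition_nonneg (y : ℝ) : 0 ≤ deriv Real.smoothTransition y :=
  Real.smoothTransition.monotone.deriv_nonneg

theorem exists_bound_smoothTransition : ∃ K : ℝ, 1 ≤ K ∧ ∀ y ∈ Icc (0 : ℝ) 1,
    deriv Real.smoothTransition y ≤ K ∧ |deriv (deriv Real.smoothTransition) y| ≤ K := by
  have c1 : Continuous (deriv Real.smoothTransition) := contDiff_deriv_smoothTransition.continuous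
  have c2 : Continuous (deriv (deriv Real.smoothTransition)) :=
    (contDiff_infty_iff_deriv.1 contDiff_deriv_smoothTransition).2.continuous
  obtain ⟨K₁, h₁⟩ := isCompact_Icc.exists_bound_of_continuousOn (s := Icc (0 : ℝ) 1) c1.continuousOn
  obtain ⟨K₂, h₂⟩ := isCompact_Icc.exists_bound_of_continuousOn (s := Icc (0 : ℝ) 1) c2.continuousOn
  refine ⟨max 1 (max K₁ K₂), le_max_left _ _, fun y hy => ⟨?_, ?_⟩⟩
  · exact (le_abs_self _).trans ((h₁ y hy).trans (by simp))
  · exact (h₂ y hy).trans (by simp)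

end Step

section Ramp

/-- The affine function `p + a t`, whose slope is increased by `Δ` and whose value is shifted by `e`
during the time interval `[0, T]`. -/
noncomputable def ramp (p a Δ e T t : ℝ) : ℝ :=
  p + a * t + Δ * T * stepInt (t / T) + e * Real.smoothTransition (t / T)

variable {p a Δ e T : ℝ}

theorem contDiff_ramp : ContDiff ℝ ∞ (ramp p a Δ e T) := by
  unfold ramp
  have h : ContDiff ℝ ∞ (fun t : ℝ => t / T) := contDiff_id.div_const T
  exact ((contDiff_const.add (contDiff_const.mul contDiff_id)).add
    (contDiff_const.mul (contDiff_stepInt.comp h))).add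
    (contDiff_const.mul (Real.smoothTransition.contDiff.comp h))

theorem deriv_ramp (hT : 0 < T) : deriv (ramp p a Δ e T) = fun t =>
    a + Δ * Real.smoothTransition (t / T) + e / T * deriv Real.smoothTransition (t / T) := by
  funext t
  have h : HasDerivAt (fun t : ℝ => t / T) (1 / T) t := (hasDerivAt_id t).div_const T
  have h1 := (hasDerivAt_stepInt (t / T)).comp t h
  have h2 := (differentiable_smoothTransition (t / T)).hasDerivAt.comp t h
  have h3 := ((((hasDerivAt_id t).const_mul a).const_add p).add (h1.const_mul (Δ * T))).add
    (h2.const_mul e)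
  refine (HasDerivAt.congr_deriv (f := ramp p a Δ e T) h3 ?_).deriv
  field_simp

theorem deriv_deriv_ramp (hT : 0 < T) : deriv (deriv (ramp p a Δ e T)) = fun t =>
    Δ / T * deriv Real.smoothTransition (t / T)
      + e / T ^ 2 * deriv (deriv Real.smoothTransition) (t / T) := by
  rw [deriv_ramp hT]
  funext t
  have h : HasDerivAt (fun t : ℝ => t / T) (1 / T) t := (hasDerivAt_id t).div_const T
  have h1 := (differentiable_smoothTransition (t / T)).hasDerivAt.comp t h
  have h2 := (((contDiff_deriv_smoothTransition.differentiable (by norm_num)) (t / T)).hasDerivAt).comp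
    t h
  have h3 := ((h1.const_mul Δ).const_add a).add (h2.const_mul (e / T))
  refine (HasDerivAt.congr_deriv h3 ?_).deriv
  field_simp

theorem ramp_of_nonpos (hT : 0 < T) {t : ℝ} (ht : t ≤ 0) : ramp p a Δ e T t = p + a * t := by
  have h : t / T ≤ 0 := div_nonpos_of_nonpos_of_nonneg ht hT.le
  simp [ramp, stepInt_of_nonpos h, Real.smoothTransition.zero_of_nonpos h]

theorem ramp_of_le (hT : 0 < T) {t : ℝ} (ht : T ≤ t) : ramp p a Δ e T t =
    (p + a * T + Δ * T * stepInt 1 + e) + (a + Δ) * (t - T) := by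
  have h : 1 ≤ t / T := (one_le_div hT).2 ht
  rw [ramp, stepInt_of_one_le h, Real.smoothTransition.one_of_one_le h]
  field_simp
  ring

end Ramp

section Paths

/-- The pointwise curvature conditions on `dr² + (r eᵘ)² g_{S^m} + (r eᵛ)² g_{S^n} + (λ eʷ)² g_{S^2}`
in the variable `t = log r`: here `a`, `b`, `s` stand for the first and `a'`, `b'`, `s'` for the
second derivatives of `u`, `v`, `w`. The condition on the last factor is absent, since it holds
for small `λ`. -/
def CurvCond (m n u v a b s a' b' s' : ℝ) : Prop :=
  m * (a' + a + a ^ 2) + n * (b' + b + b ^ 2) + 2 * (s' - s + s ^ 2) ≤ 0 ∧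
  a' + (1 + a) * (m * (1 + a) + n * (1 + b) + 2 * s - 1) ≤ (m - 1) * Real.exp (-2 * u) ∧
  b' + (1 + b) * (m * (1 + a) + n * (1 + b) + 2 * s - 1) ≤ (n - 1) * Real.exp (-2 * v)

/-- `CurvCond` for three functions at the time `t`. -/
def CurvAt (m n : ℝ) (u v w : ℝ → ℝ) (t : ℝ) : Prop :=
  CurvCond m n (u t) (v t) (deriv u t) (deriv v t) (deriv w t)
    (deriv (deriv u) t) (deriv (deriv v) t) (deriv (deriv w) t)

/-- Values and slopes of the exponents `u`, `v`, `w` at an end of a time interval, beyond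
which they are affine. -/
@[ext]
structure State where
  /-- The value of `u`. -/
  u : ℝ
  /-- The value of `v`. -/
  v : ℝ
  /-- The value of `w`. -/
  w : ℝ
  /-- The slope of `u`. -/
  a : ℝ
  /-- The slope of `v`. -/
  b : ℝ
  /-- The slope of `w`. -/
  s : ℝ

/-- The three functions are affine up to the time `0`, where they are in the state `X`, and from the
time `T` on, where they are in the state `Y`; in between they satisfy the curvature conditions. -/
structure Path (m n : ℝ) (X Y : State) (T : ℝ) (u v w : ℝ → ℝ) : Prop where
  pos : 0 < T
  smooth : ContDiff ℝ ∞ u ∧ ContDiff ℝ ∞ v ∧ ContDiff ℝ ∞ w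
  before : ∀ t ≤ 0, u t = X.u + X.a * t ∧ v t = X.v + X.b * t ∧ w t = X.w + X.s * t
  after : ∀ t, T ≤ t →
    u t = Y.u + Y.a * (t - T) ∧ v t = Y.v + Y.b * (t - T) ∧ w t = Y.w + Y.s * (t - T)
  cond : ∀ t ∈ Icc 0 T, CurvAt m n u v w t

/-- The state `Y` can be reached from the state `X` in time `T`. -/
def Reach (m n : ℝ) (X Y : State) (T : ℝ) : Prop := ∃ u v w, Path m n X Y T u v w

variable {m n : ℝ} {u v w : ℝ → ℝ} {X Y Z : State} {T T' : ℝ}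

theorem contDiff_deriv_of_contDiff {f : ℝ → ℝ} (hf : ContDiff ℝ ∞ f) : ContDiff ℝ ∞ (deriv f) :=
  (contDiff_infty_iff_deriv.1 hf).2

theorem isClosed_curvAt (hu : ContDiff ℝ ∞ u) (hv : ContDiff ℝ ∞ v) (hw : ContDiff ℝ ∞ w) :
    IsClosed {t | CurvAt m n u v w t} := by
  have c0 := hu.continuous
  have c1 := (contDiff_deriv_of_contDiff hu).continuous
  have c2 := (contDiff_deriv_of_contDiff (contDiff_deriv_of_contDiff hu)).continuous
  have d0 := hv.continuous
  have d1 := (contDiff_deriv_of_contDiff hv).continuous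
  have d2 := (contDiff_deriv_of_contDiff (contDiff_deriv_of_contDiff hv)).continuous
  have e1 := (contDiff_deriv_of_contDiff hw).continuous
  have e2 := (contDiff_deriv_of_contDiff (contDiff_deriv_of_contDiff hw)).continuous
  unfold CurvAt CurvCond
  refine IsClosed.and ?_ (IsClosed.and ?_ ?_)
  · exact isClosed_le (by fun_prop) continuous_const
  · exact isClosed_le (by fun_prop) (by fun_prop)
  · exact isClosed_le (by fun_prop) (by fun_prop)

theorem CurvAt.congr {u' v' w' : ℝ → ℝ} {t : ℝ} (h : CurvAt m n u v w t) (hu : u' =ᶠ[𝓝 t] u)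
    (hv : v' =ᶠ[𝓝 t] v) (hw : w' =ᶠ[𝓝 t] w) : CurvAt m n u' v' w' t := by
  unfold CurvAt
  rw [hu.eq_of_nhds, hv.eq_of_nhds, hu.deriv_eq, hv.deriv_eq, hw.deriv_eq, hu.deriv.deriv_eq,
    hv.deriv.deriv_eq, hw.deriv.deriv_eq]
  exact h

theorem CurvAt.comp_sub_const {t : ℝ} (c : ℝ) (h : CurvAt m n u v w (t - c)) :
    CurvAt m n (fun t => u (t - c)) (fun t => v (t - c)) (fun t => w (t - c)) t := by
  have D : ∀ f : ℝ → ℝ, deriv (fun t => f (t - c)) = fun t => deriv f (t - c) := fun f =>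
    funext fun x => deriv_comp_sub_const f c x
  unfold CurvAt
  simp only [D]
  exact h

/-- Concatenation of paths. The curvature conditions are closed, so that nothing has to be checked
at the time `T` itself. -/
theorem Path.trans {u' v' w' : ℝ → ℝ} (h : Path m n X Y T u v w) (h' : Path m n Y Z T' u' v' w') :
    ∃ U V W, Path m n X Z (T + T') U V W ∧ (∀ t ≤ T, U t = u t ∧ V t = v t ∧ W t = w t) ∧
      ∀ t, T ≤ t → U t = u' (t - T) ∧ V t = v' (t - T) ∧ W t = w' (t - T) := by
  have glue : ∀ (f g : ℝ → ℝ) (p q : ℝ), (∀ t, T ≤ t → f t = p + q * (t - T)) →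
      (∀ t ≤ 0, g t = p + q * t) → ContDiff ℝ ∞ f → ContDiff ℝ ∞ g →
      ∃ F : ℝ → ℝ, ContDiff ℝ ∞ F ∧ (∀ t ≤ T, F t = f t) ∧ ∀ t, T ≤ t → F t = g (t - T) := by
    -- both summands agree with the affine function on one side of `T`
    intro f g p q hf hg cf cg
    refine ⟨fun t => f t + g (t - T) - (p + q * (t - T)), ?_, fun t ht => ?_, fun t ht => ?_⟩
    · exact (cf.add (cg.comp (contDiff_id.sub contDiff_const))).sub
        (contDiff_const.add (contDiff_const.mul (contDiff_id.sub contDiff_const)))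
    · simp [hg (t - T) (by linarith)]
    · simp [hf t ht]
  obtain ⟨U, cU, U1, U2⟩ := glue u u' Y.u Y.a (fun t ht => (h.after t ht).1)
    (fun t ht => (h'.before t ht).1) h.smooth.1 h'.smooth.1
  obtain ⟨V, cV, V1, V2⟩ := glue v v' Y.v Y.b (fun t ht => (h.after t ht).2.1)
    (fun t ht => (h'.before t ht).2.1) h.smooth.2.1 h'.smooth.2.1
  obtain ⟨W, cW, W1, W2⟩ := glue w w' Y.w Y.s (fun t ht => (h.after t ht).2.2)
    (fun t ht => (h'.before t ht).2.2) h.smooth.2.2 h'.smooth.2.2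
  have hT := h.pos
  have hT' := h'.pos
  have hcl := isClosed_curvAt (m := m) (n := n) cU cV cW
  have i1 : Icc 0 T ⊆ {t | CurvAt m n U V W t} := by
    rw [← closure_Ioo hT.ne]
    refine closure_minimal (fun t ht => ?_) hcl
    have hn : ∀ᶠ x in 𝓝 t, x ≤ T := 
      Filter.Eventually.mono (Iio_mem_nhds ht.2) fun x hx => le_of_lt hx
    exact (h.cond t (Ioo_subset_Icc_self ht)).congr (hn.mono U1) (hn.mono V1) (hn.mono W1)
  have i2 : Icc T (T + T') ⊆ {t | CurvAt m n U V W t} := by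
    rw [← closure_Ioo (by linarith)]
    refine closure_minimal (fun t ht => ?_) hcl
    have hn : ∀ᶠ x in 𝓝 t, T ≤ x := 
      Filter.Eventually.mono (Ioi_mem_nhds ht.1) fun x hx => le_of_lt hx
    exact ((h'.cond (t - T) ⟨by linarith [ht.1], by linarith [ht.2]⟩).comp_sub_const).congr
      (hn.mono U2) (hn.mono V2) (hn.mono W2)
  refine ⟨U, V, W, ⟨by linarith, ⟨cU, cV, cW⟩, fun t ht => ?_, fun t ht => ?_, fun t ht => ?_⟩,
    fun t ht => ⟨U1 t ht, V1 t ht, W1 t ht⟩, fun t ht => ⟨U2 t ht, V2 t ht, W2 t ht⟩⟩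
  · have htT : t ≤ T := by linarith
    rw [U1 t htT, V1 t htT, W1 t htT]
    exact h.before t ht
  · have htT : T ≤ t := by linarith
    rw [U2 t htT, V2 t htT, W2 t htT, ← sub_sub]
    exact h'.after (t - T) (by linarith)
  · rcases le_total t T with h1 | h1
    · exact i1 ⟨ht.1, h1⟩
    · exact i2 ⟨h1, ht.2⟩

theorem Reach.trans (h : Reach m n X Y T) (h' : Reach m n Y Z T') : Reach m n X Z (T + T') := by
  obtain ⟨u, v, w, h⟩ := h
  obtain ⟨u', v', w', h'⟩ := h'
  obtain ⟨U, V, W, H, -⟩ := h.trans h'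
  exact ⟨U, V, W, H⟩

theorem Path.swap (h : Path m n X Y T u v w) :
    Path n m ⟨X.v, X.u, X.w, X.b, X.a, X.s⟩ ⟨Y.v, Y.u, Y.w, Y.b, Y.a, Y.s⟩ T v u w where
  pos := h.pos
  smooth := ⟨h.smooth.2.1, h.smooth.1, h.smooth.2.2⟩
  before t ht := ⟨(h.before t ht).2.1, (h.before t ht).1, (h.before t ht).2.2⟩
  after t ht := ⟨(h.after t ht).2.1, (h.after t ht).1, (h.after t ht).2.2⟩
  cond t ht := by
    obtain ⟨h1, h2, h3⟩ := h.cond t ht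
    exact ⟨by linarith, by linarith, by linarith⟩

/-- Changing the slopes by `da`, `db`, `ds` and shifting the values by `eu`, `ev` in time `T`. -/
theorem path_ramp (X : State) (da db ds eu ev : ℝ) (hT : 0 < T)
    (h : ∀ y ∈ Icc (0 : ℝ) 1, CurvCond m n
      (X.u + X.a * (T * y) + da * T * stepInt y + eu * Real.smoothTransition y)
      (X.v + X.b * (T * y) + db * T * stepInt y + ev * Real.smoothTransition y)
      (X.a + da * Real.smoothTransition y + eu / T * deriv Real.smoothTransition y)
      (X.b + db * Real.smoothTransition y + ev / T * deriv Real.smoothTransition y)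
      (X.s + ds * Real.smoothTransition y)
      (da / T * deriv Real.smoothTransition y + eu / T ^ 2 * deriv (deriv Real.smoothTransition) y)
      (db / T * deriv Real.smoothTransition y + ev / T ^ 2 * deriv (deriv Real.smoothTransition) y)
      (ds / T * deriv Real.smoothTransition y)) :
    Path m n X ⟨X.u + X.a * T + da * T * stepInt 1 + eu, X.v + X.b * T + db * T * stepInt 1 + ev,
        X.w + X.s * T + ds * T * stepInt 1, X.a + da, X.b + db, X.s + ds⟩ T
      (ramp X.u X.a da eu T) (ramp X.v X.b db ev T) (ramp X.w X.s ds 0 T) where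
  pos := hT
  smooth := ⟨contDiff_ramp, contDiff_ramp, contDiff_ramp⟩
  before t ht := ⟨ramp_of_nonpos hT ht, ramp_of_nonpos hT ht, ramp_of_nonpos hT ht⟩
  after t ht := ⟨ramp_of_le hT ht, ramp_of_le hT ht, by rw [ramp_of_le hT ht]; simp⟩
  cond t ht := by
    have hy : t / T ∈ Icc (0 : ℝ) 1 := ⟨div_nonneg ht.1 hT.le, (div_le_one hT).2 ht.2⟩
    have := h _ hy
    rw [mul_div_cancel₀ t hT.ne'] at this
    unfold CurvAt
    rw [deriv_deriv_ramp hT, deriv_deriv_ramp hT, deriv_deriv_ramp hT, deriv_ramp hT, deriv_ramp hT,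
      deriv_ramp hT]
    simp only [ramp]
    simpa using this

end Paths

/-! ### From the cone to a constant first sphere -/

section Moves

variable {m n κ K : ℝ}

/-- `K` bounds the first two derivatives of the smooth step function. -/
def StepBound (K : ℝ) : Prop := 1 ≤ K ∧ ∀ y ∈ Icc (0 : ℝ) 1,
  deriv Real.smoothTransition y ≤ K ∧ |deriv (deriv Real.smoothTransition) y| ≤ K

/-- `path_ramp`, with the step function, its derivatives and its primitive replaced by numbers that
satisfy the bounds known for them. -/
theorem reach_ramp (hK : StepBound K) (X Y : State) (da db ds eu ev : ℝ) {T : ℝ} (hT : 0 < T)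
    (ha : Y.a = X.a + da) (hb : Y.b = X.b + db) (hs : Y.s = X.s + ds)
    (hu : Y.u = X.u + X.a * T + da * T * stepInt 1 + eu)
    (hv : Y.v = X.v + X.b * T + db * T * stepInt 1 + ev)
    (hw : Y.w = X.w + X.s * T + ds * T * stepInt 1)
    (h : ∀ y S q q₁ q₂ : ℝ, 0 ≤ y → y ≤ 1 → 0 ≤ S → S ≤ y → 0 ≤ q → q ≤ 1 → 0 ≤ q₁ → q₁ ≤ K →
      |q₂| ≤ K → CurvCond m n (X.u + X.a * (T * y) + da * T * S + eu * q)
        (X.v + X.b * (T * y) + db * T * S + ev * q) (X.a + da * q + eu / T * q₁)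
        (X.b + db * q + ev / T * q₁) (X.s + ds * q) (da / T * q₁ + eu / T ^ 2 * q₂)
        (db / T * q₁ + ev / T ^ 2 * q₂) (ds / T * q₁)) : Reach m n X Y T := by
  have hp := path_ramp (m := m) (n := n) X da db ds eu ev hT fun y hy =>
    h y _ _ _ _ hy.1 hy.2 (stepInt_nonneg hy.1) (stepInt_le hy.1)
      (Real.smoothTransition.nonneg y) (Real.smoothTransition.le_one y)
      (deriv_smoothTransition_nonneg y) (hK.2 y hy).1 (hK.2 y hy).2
  rw [← ha, ← hb, ← hs, ← hu, ← hv, ← hw] at hp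
  exact ⟨_, _, _, hp⟩

theorem transverse_le {A B C s c : ℝ} (hm : 2 ≤ m) (hn : 2 ≤ n) (hA : A ≤ 5 / 4) (hB : B ≤ 5 / 4)
    (hC₀ : 0 ≤ C) (hC : C ≤ 5 / 4) (hs : s ≤ 1 / 2) (hc : c ≤ 1) :
    c + C * (m * A + n * B + 2 * s - 1) ≤ 4 * (m + n + 5) := by
  have h1 : m * A + n * B + 2 * s - 1 ≤ 5 / 4 * (m + n) := by nlinarith
  have h2 := mul_le_mul_of_nonneg_left h1 hC₀
  nlinarith

theorem le_mul_exp {x : ℝ} (hm : 2 ≤ m) (hn : 2 ≤ n) (hκ : 4 * (m + n + 5) ≤ Real.exp (-2 * κ))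
    {d : ℝ} (hd : 2 ≤ d) (hx : x ≤ κ) : 4 * (m + n + 5) ≤ (d - 1) * Real.exp (-2 * x) := by
  have h1 : Real.exp (-2 * κ) ≤ Real.exp (-2 * x) := Real.exp_le_exp.2 (by linarith)
  nlinarith [Real.exp_pos (-2 * x)]

/-- As long as `u` and `v` are at most `κ` and the slopes are moderate, only the radial direction
matters. -/
theorem curvCond_of_le {u v a b s a' b' s' : ℝ} (hm : 2 ≤ m) (hn : 2 ≤ n)
    (hκ : 4 * (m + n + 5) ≤ Real.exp (-2 * κ)) (hu : u ≤ κ) (hv : v ≤ κ)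
    (ha₀ : -1 ≤ a) (ha : a ≤ 1 / 4) (hb₀ : -1 ≤ b) (hb : b ≤ 1 / 4) (hs : s ≤ 1 / 2)
    (ha' : a' ≤ 1) (hb' : b' ≤ 1)
    (h : m * (a' + a + a ^ 2) + n * (b' + b + b ^ 2) + 2 * (s' - s + s ^ 2) ≤ 0) :
    CurvCond m n u v a b s a' b' s' :=
  ⟨h, (transverse_le hm hn (by linarith) (by linarith) (by linarith) (by linarith) hs ha').trans
      (le_mul_exp hm hn hκ hm hu),
    (transverse_le hm hn (by linarith) (by linarith) (by linarith) (by linarith) hs hb').trans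
      (le_mul_exp hm hn hκ hn hv)⟩

theorem reach_wait_cone (hK : StepBound K) (hm : 2 ≤ m) (hn : 2 ≤ n)
    (hκ : 4 * (m + n + 5) ≤ Real.exp (-2 * κ)) (w : ℝ) {T : ℝ} (hT : 0 < T) :
    Reach m n ⟨κ, κ, w, 0, 0, 0⟩ ⟨κ, κ, w, 0, 0, 0⟩ T := by
  refine reach_ramp hK _ _ 0 0 0 0 0 hT (by simp) (by simp) (by simp) (by simp) (by simp)
    (by simp) fun y S q q₁ q₂ hy₀ hy₁ hS₀ hS hq₀ hq hq₁₀ hq₁ hq₂ => ?_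
  exact curvCond_of_le hm hn hκ (by simp) (by simp) (by norm_num) (by norm_num) (by norm_num)
    (by norm_num) (by norm_num) (by norm_num) (by norm_num) (by norm_num)

/-- The radius of the first sphere becomes nearly constant, of order `r^α`. -/
theorem reach_lower_slope (hK : StepBound K) (hm : 2 ≤ m) (hn : 2 ≤ n)
    (hκ : 4 * (m + n + 5) ≤ Real.exp (-2 * κ)) {α : ℝ} (hα₀ : 0 < α) (hα : α ≤ 1) (w : ℝ) :
    Reach m n ⟨κ, κ, w, 0, 0, 0⟩ ⟨κ + (α - 1) * stepInt 1, κ, w, α - 1, 0, 0⟩ 1 := by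
  refine reach_ramp hK _ _ (α - 1) 0 0 0 0 one_pos (by simp) (by simp) (by simp) (by simp)
    (by simp) (by simp) fun y S q q₁ q₂ hy₀ hy₁ hS₀ hS hq₀ hq hq₁₀ hq₁ hq₂ => ?_
  have e1 : (α - 1) * S ≤ 0 := mul_nonpos_of_nonpos_of_nonneg (by linarith) hS₀
  have e2 : (α - 1) * q ≤ 0 := mul_nonpos_of_nonpos_of_nonneg (by linarith) hq₀
  have e3 : (α - 1) * q₁ ≤ 0 := mul_nonpos_of_nonpos_of_nonneg (by linarith) hq₁₀
  have e4 : 0 ≤ 1 + (α - 1) * q := by nlinarith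
  have e5 : (α - 1) * q * (1 + (α - 1) * q) ≤ 0 := mul_nonpos_of_nonpos_of_nonneg e2 e4
  refine curvCond_of_le hm hn hκ ?_ ?_ ?_ ?_ ?_ ?_ ?_ ?_ ?_ ?_ <;> norm_num
  · linarith
  · linarith
  · linarith
  · linarith
  · refine mul_nonpos_of_nonneg_of_nonpos (by linarith) ?_
    nlinarith

/-- While the slope of the first sphere lies strictly between `0` and `1`, there is room for a slow
change of the ratio `e^v` for the second one. -/
theorem exists_reach_shift (hK : StepBound K) (hm : 2 ≤ m) (hn : 2 ≤ n)
    (hκ : 4 * (m + n + 5) ≤ Real.exp (-2 * κ)) {α D μ u₁ : ℝ} (hα₀ : 0 < α) (hα : α ≤ 1 / 2)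
    (hD : 1 < D) (hDn : ∀ x, x ≤ max κ μ → (n - 1) * D ≤ (n - 1) * Real.exp (-2 * x))
    (hαD : m * α ≤ (D - 1) / 2) (hu₁ : u₁ ≤ κ) (w : ℝ) :
    ∃ T, 0 < T ∧ Reach m n ⟨u₁, κ, w, α - 1, 0, 0⟩ ⟨u₁ + (α - 1) * T, μ, w, α - 1, 0, 0⟩ T := by
  obtain ⟨η, hη₀, hη, hη₁, hη₂⟩ : ∃ η : ℝ, 0 < η ∧ η ≤ 1 / 4 ∧ 3 * n * η ≤ m * (α / 2) ∧
      (m + 3 * n + 1) * η ≤ (D - 1) / 2 := by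
    refine ⟨min (1 / 4) (min (m * (α / 2) / (3 * n)) ((D - 1) / 2 / (m + 3 * n + 1))),
      lt_min (by norm_num) (lt_min (by positivity) (div_pos (by linarith) (by linarith))),
      min_le_left _ _, ?_, ?_⟩
    · rw [mul_comm, ← le_div_iff₀ (by linarith)]
      exact (min_le_right _ _).trans (min_le_left _ _)
    · rw [mul_comm, ← le_div_iff₀ (by linarith)]
      exact (min_le_right _ _).trans (min_le_right _ _)
  set V := μ - κ with hV
  have hK₁ := hK.1
  obtain ⟨T, hT₁, hT⟩ : ∃ T : ℝ, 1 ≤ T ∧ |V| * K ≤ η * T := by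
    refine ⟨max 1 (|V| * K / η), le_max_left _ _, ?_⟩
    rw [mul_comm η, ← div_le_iff₀ hη₀]
    exact le_max_right _ _
  have hT₀ : 0 < T := by linarith
  refine ⟨T, hT₀, ?_⟩
  refine reach_ramp hK _ _ 0 0 0 0 V hT₀ (by simp) (by simp) (by simp) (by simp)
    (by simp [hV]) (by simp) fun y S q q₁ q₂ hy₀ hy₁ hS₀ hS hq₀ hq hq₁₀ hq₁ hq₂ => ?_
  have b₁ : |V / T * q₁| ≤ η := by
    rw [abs_mul, abs_div, abs_of_pos hT₀, abs_of_nonneg hq₁₀, div_mul_eq_mul_div,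
      div_le_iff₀ hT₀]
    exact (mul_le_mul_of_nonneg_left hq₁ (abs_nonneg _)).trans hT
  have b₂ : |V / T ^ 2 * q₂| ≤ η := by
    rw [abs_mul, abs_div, abs_of_pos (pow_pos hT₀ 2), div_mul_eq_mul_div,
      div_le_iff₀ (pow_pos hT₀ 2)]
    refine (mul_le_mul_of_nonneg_left hq₂ (abs_nonneg _)).trans (hT.trans ?_)
    exact mul_le_mul_of_nonneg_left (by nlinarith) hη₀.le
  have hv : κ + V * q ≤ max κ μ := by
    have e : κ + V * q = (1 - q) * κ + q * μ := by rw [hV]; ring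
    rw [e]
    nlinarith [mul_le_mul_of_nonneg_left (le_max_left κ μ) (sub_nonneg.2 hq),
      mul_le_mul_of_nonneg_left (le_max_right κ μ) hq₀]
  have hu : u₁ + (α - 1) * (T * y) ≤ κ := by nlinarith [mul_nonneg hT₀.le hy₀]
  obtain ⟨b₁l, b₁u⟩ := abs_le.1 b₁
  obtain ⟨b₂l, b₂u⟩ := abs_le.1 b₂
  set b := V / T * q₁
  set b' := V / T ^ 2 * q₂
  have hbb : b ^ 2 ≤ η := by nlinarith
  refine ⟨?_, ?_, ?_⟩ <;> simp only [mul_zero, zero_mul, add_zero, zero_add, zero_div, sub_zero,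
    ne_eq, OfNat.ofNat_ne_zero, not_false_eq_true, zero_pow]
  · have e1 : n * (b' + b + b ^ 2) ≤ n * (3 * η) :=
      mul_le_mul_of_nonneg_left (by linarith) (by linarith)
    have e2 : m * (α - 1 + (α - 1) ^ 2) ≤ m * (-(α / 2)) :=
      mul_le_mul_of_nonneg_left (by nlinarith) (by linarith)
    linarith
  · refine le_trans (le_of_eq ?_) ((transverse_le (A := α) (B := 1 + b) (C := α) (s := 0)
      (c := 0) hm hn (by linarith) (by linarith) hα₀.le (by linarith) (by norm_num)
      (by norm_num)).trans (le_mul_exp hm hn hκ hm hu))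
    ring
  · refine le_trans ?_ (hDn _ hv)
    have hP : m * (1 + (α - 1)) + n * (1 + b) - 1 = m * α + n + n * b - 1 := by ring
    rw [hP]
    have f1 : n * b ≤ n * η := mul_le_mul_of_nonneg_left b₁u (by linarith)
    have f2 : n * (-(1 / 4)) ≤ n * b := mul_le_mul_of_nonneg_left (by linarith) (by linarith)
    have f3 : n * b ≤ n * (1 / 4) := mul_le_mul_of_nonneg_left (by linarith) (by linarith)
    have f4 : 0 ≤ m * α := mul_nonneg (by linarith) hα₀.le
    have f5 : m * α ≤ m * (1 / 2) := mul_le_mul_of_nonneg_left hα (by linarith)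
    set P := m * α + n + n * b - 1 with hPdef
    have f6 : b * P ≤ η * P := mul_le_mul_of_nonneg_right b₁u (by linarith)
    have f7 : η * P ≤ η * (m + 2 * n) := mul_le_mul_of_nonneg_left (by linarith) hη₀.le
    have f8 : 0 ≤ (n - 2) * (D - 1) := mul_nonneg (by linarith) (by linarith)
    linarith

/-- The radius of the first sphere becomes constant. -/
theorem reach_stop (hK : StepBound K) (hm : 2 ≤ m) (hn : 2 ≤ n)
    (hκ : 4 * (m + n + 5) ≤ Real.exp (-2 * κ)) {α D μ u₂ : ℝ} (hα₀ : 0 < α) (hα : α ≤ 1 / 2)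
    (hD : 1 < D) (hDn : (n - 1) * D ≤ (n - 1) * Real.exp (-2 * μ))
    (hαD : m * α ≤ (D - 1) / 2) (hu₂ : u₂ ≤ κ) (w : ℝ) :
    Reach m n ⟨u₂, μ, w, α - 1, 0, 0⟩ ⟨u₂ + (α - 1) + -α * stepInt 1, μ, w, -1, 0, 0⟩ 1 := by
  refine reach_ramp hK _ _ (-α) 0 0 0 0 one_pos (by ring) (by simp) (by simp) (by simp)
    (by simp) (by simp) fun y S q q₁ q₂ hy₀ hy₁ hS₀ hS hq₀ hq hq₁₀ hq₁ hq₂ => ?_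
  have e1 : 0 ≤ α * (1 - q) := mul_nonneg hα₀.le (by linarith)
  have e2 : α * (1 - q) ≤ α := by nlinarith
  have e3 : 0 ≤ α * q₁ := mul_nonneg hα₀.le hq₁₀
  have e4 : 0 ≤ α * S := mul_nonneg hα₀.le hS₀
  have e5 : (α - 1) * y ≤ 0 := mul_nonpos_of_nonpos_of_nonneg (by linarith) hy₀
  refine ⟨?_, ?_, ?_⟩ <;> simp only [mul_zero, zero_mul, add_zero, zero_add, zero_div, sub_zero,
    ne_eq, OfNat.ofNat_ne_zero, not_false_eq_true, zero_pow, mul_one, one_mul, div_one]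
  · refine mul_nonpos_of_nonneg_of_nonpos (by linarith) ?_
    nlinarith
  · refine le_trans (le_of_eq ?_) ((transverse_le (A := α * (1 - q)) (B := 1)
      (C := α * (1 - q)) (s := 0) (c := -α * q₁) hm hn (by linarith) (by norm_num) e1
      (by linarith) (by norm_num) (by linarith)).trans (le_mul_exp hm hn hκ hm ?_))
    · ring
    · linarith
  · refine le_trans ?_ hDn
    nlinarith

/-- From the cone over the product of the two spheres, where both have radius `e^κ r`, the first
sphere is brought to a constant radius and the second one to the radius `e^μ r`. -/
theorem exists_reach_split (hK : StepBound K) (hm : 2 ≤ m) (hn : 2 ≤ n)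
    (hκ : 4 * (m + n + 5) ≤ Real.exp (-2 * κ)) (hκ₀ : κ < 0) {μ : ℝ} (hμ : μ < 0) (w : ℝ) :
    ∃ u T, u ≤ κ ∧ 0 < T ∧ Reach m n ⟨κ, κ, w, 0, 0, 0⟩ ⟨u, μ, w, -1, 0, 0⟩ T := by
  obtain ⟨D, hD, hDv⟩ : ∃ D : ℝ, 1 < D ∧ ∀ x, x ≤ max κ μ → D ≤ Real.exp (-2 * x) :=
    ⟨Real.exp (-2 * max κ μ), Real.one_lt_exp_iff.2 (by linarith [max_lt hκ₀ hμ]),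
      fun x hx => Real.exp_le_exp.2 (by linarith)⟩
  have hDn : ∀ x, x ≤ max κ μ → (n - 1) * D ≤ (n - 1) * Real.exp (-2 * x) := fun x hx =>
    mul_le_mul_of_nonneg_left (hDv x hx) (by linarith)
  obtain ⟨α, hα₀, hα, hαD⟩ : ∃ α : ℝ, 0 < α ∧ α ≤ 1 / 2 ∧ m * α ≤ (D - 1) / 2 := by
    refine ⟨min (1 / 2) ((D - 1) / (2 * m)), lt_min (by norm_num) (div_pos (by linarith)
      (by linarith)), min_le_left _ _, ?_⟩
    calc m * min (1 / 2) ((D - 1) / (2 * m)) ≤ m * ((D - 1) / (2 * m)) :=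
          mul_le_mul_of_nonneg_left (min_le_right _ _) (by linarith)
      _ = (D - 1) / 2 := by field_simp
  have S₁ := stepInt_nonneg (y := 1) zero_le_one
  have R₁ := reach_lower_slope hK hm hn hκ hα₀ (by linarith) w
  have hu₁ : κ + (α - 1) * stepInt 1 ≤ κ := by nlinarith
  obtain ⟨T, hT₀, R₂⟩ := exists_reach_shift hK hm hn hκ hα₀ hα hD hDn hαD hu₁ w
  have hu₂ : κ + (α - 1) * stepInt 1 + (α - 1) * T ≤ κ := by nlinarith
  have R₃ := reach_stop hK hm hn hκ hα₀ hα hD (hDn μ (le_max_right _ _)) hαD hu₂ w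
  refine ⟨_, _, ?_, ?_, (R₁.trans R₂).trans R₃⟩
  · nlinarith
  · linarith

end Moves

/-! ### From a constant first sphere back to the cone -/

section Return

variable {m n κ K : ℝ}

/-- Starting from equality in the radial condition, lowering `B` is free: the second radius becomes
of order `r^(1/2)`, which creates the room for all that follows. -/
theorem reach_lower_second (hK : StepBound K) (hm : 2 ≤ m) (hn : 2 ≤ n) {u μ : ℝ} (hμ : μ < 0)
    (w : ℝ) : ∃ v ≤ μ, Reach m n ⟨u, μ, w, -1, 0, 0⟩ ⟨u - 1, v, w, -1, -(1 / 2), 0⟩ 1 := by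
  have S₁ := stepInt_nonneg (y := 1) zero_le_one
  refine ⟨μ + -(1 / 2) * stepInt 1, by linarith, ?_⟩
  refine reach_ramp hK _ _ 0 (-(1 / 2)) 0 0 0 one_pos (by simp) (by simp) (by simp) (by ring)
    (by simp) (by simp) fun y S q q₁ q₂ hy₀ hy₁ hS₀ hS hq₀ hq hq₁₀ hq₁ hq₂ => ?_
  refine ⟨?_, ?_, ?_⟩ <;> simp only [mul_zero, zero_mul, add_zero, zero_add, zero_div,
    mul_one, one_mul, div_one, sub_zero, ne_eq, OfNat.ofNat_ne_zero, not_false_eq_true, zero_pow]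
  · have e1 : m * (-1 + (-1) ^ 2) = 0 := by ring
    rw [e1, zero_add]
    refine mul_nonpos_of_nonneg_of_nonpos (by linarith) ?_
    nlinarith
  · rw [add_neg_cancel, zero_mul]
    exact mul_nonneg (by linarith) (Real.exp_pos _).le
  · have e1 : 1 ≤ Real.exp (-2 * (μ + -(1 / 2) * S)) := Real.one_le_exp (by linarith)
    have e2 : (n - 1) * 1 ≤ (n - 1) * Real.exp (-2 * (μ + -(1 / 2) * S)) :=
      mul_le_mul_of_nonneg_left e1 (by linarith)
    have e3 : 0 ≤ n * q := mul_nonneg (by linarith) hq₀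
    have e4 : n * (1 + -(1 / 2) * q) - 1 ≤ n - 1 := by linarith
    have e5 : (1 + -(1 / 2) * q) * (n * (1 + -(1 / 2) * q) - 1) ≤
        (1 + -(1 / 2) * q) * (n - 1) := mul_le_mul_of_nonneg_left e4 (by linarith)
    have e6 : 0 ≤ q * (n - 1) := mul_nonneg hq₀ (by linarith)
    rw [add_neg_cancel, mul_zero, zero_add]
    linarith

/-- Waiting makes the ratio `e^v` as small as on the cone. -/
theorem exists_reach_wait_second (hK : StepBound K) (hm : 2 ≤ m) (hn : 2 ≤ n) {u v : ℝ}
    (hu : u ≤ κ) (hv : v < 0) (w : ℝ) : ∃ u' T v', u' ≤ κ ∧ v' ≤ κ ∧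
      Reach m n ⟨u, v, w, -1, -(1 / 2), 0⟩ ⟨u', v', w, -1, -(1 / 2), 0⟩ T := by
  have hT : 0 < max 1 (2 * (v - κ)) := lt_max_of_lt_left one_pos
  refine ⟨u - max 1 (2 * (v - κ)), max 1 (2 * (v - κ)), v - max 1 (2 * (v - κ)) / 2, by linarith,
    by linarith [le_max_right 1 (2 * (v - κ))], ?_⟩
  refine reach_ramp hK _ _ 0 0 0 0 0 hT (by simp) (by simp) (by simp) (by ring)
    (by ring) (by simp) fun y S q q₁ q₂ hy₀ hy₁ hS₀ hS hq₀ hq hq₁₀ hq₁ hq₂ => ?_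
  refine ⟨?_, ?_, ?_⟩ <;> simp only [mul_zero, zero_mul, add_zero, zero_add, zero_div,
    sub_zero, ne_eq, OfNat.ofNat_ne_zero, not_false_eq_true, zero_pow]
  · have e1 : m * (-1 + (-1) ^ 2) = 0 := by ring
    rw [e1]
    linarith
  · rw [add_neg_cancel, zero_mul]
    exact mul_nonneg (by linarith) (Real.exp_pos _).le
  · have e0 : 0 ≤ max 1 (2 * (v - κ)) * y := mul_nonneg hT.le hy₀
    have e1 : 1 ≤ Real.exp (-2 * (v + -(1 / 2) * (max 1 (2 * (v - κ)) * y))) :=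
      Real.one_le_exp (by linarith)
    have e2 := mul_le_mul_of_nonneg_left e1 (show 0 ≤ n - 1 by linarith)
    rw [add_neg_cancel, mul_zero, zero_add]
    linarith

/-- The radius of the last factor starts to grow like `r^s`; its concavity pays for the later steps. -/
theorem reach_raise_third (hK : StepBound K) (hm : 2 ≤ m) (hn : 2 ≤ n)
    (hκ : 4 * (m + n + 5) ≤ Real.exp (-2 * κ)) {u v s : ℝ} (hu : u ≤ κ) (hv : v ≤ κ)
    (hs₀ : 0 ≤ s) (hs : s * K ≤ 1 / 4) (w : ℝ) : ∃ u' v' w', u' ≤ κ ∧ v' ≤ κ ∧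
      Reach m n ⟨u, v, w, -1, -(1 / 2), 0⟩ ⟨u', v', w', -1, -(1 / 2), s⟩ 1 := by
  have hK₁ := hK.1
  have hs₁ : s ≤ 1 / 4 := by nlinarith
  refine ⟨u - 1, v - 1 / 2, w + s * stepInt 1, by linarith, by linarith, ?_⟩
  refine reach_ramp hK _ _ 0 0 s 0 0 one_pos (by simp) (by simp) (by simp) (by ring)
    (by ring) (by simp) fun y S q q₁ q₂ hy₀ hy₁ hS₀ hS hq₀ hq hq₁₀ hq₁ hq₂ => ?_
  have e1 : s * q ≤ s := by nlinarith
  have e2 : 0 ≤ s * q := mul_nonneg hs₀ hq₀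
  have e3 : s * q₁ ≤ s * K := mul_le_mul_of_nonneg_left hq₁ hs₀
  refine curvCond_of_le hm hn hκ ?_ ?_ ?_ ?_ ?_ ?_ ?_ ?_ ?_ ?_ <;> norm_num
  · linarith
  · linarith
  · linarith
  · nlinarith

/-- The first sphere becomes conical again. -/
theorem exists_reach_raise_first (hK : StepBound K) (hm : 2 ≤ m) (hn : 2 ≤ n)
    (hκ : 4 * (m + n + 5) ≤ Real.exp (-2 * κ)) {u v s : ℝ} (hu : u ≤ κ) (hv : v ≤ κ)
    (hs₀ : 0 ≤ s) (hs : s ≤ 1 / 4) (w : ℝ) : ∃ u' v' w' T, u' ≤ κ ∧ v' ≤ κ ∧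
      Reach m n ⟨u, v, w, -1, -(1 / 2), s⟩ ⟨u', v', w', 0, -(1 / 2), s⟩ T := by
  have hK₁ := hK.1
  obtain ⟨T, hT₀, hTdef⟩ : ∃ T : ℝ, 0 < T ∧ T = 2 * m * K := ⟨_, by positivity, rfl⟩
  have S₁ := stepInt_nonneg (y := 1) zero_le_one
  have S₂ := stepInt_le (y := 1) zero_le_one
  refine ⟨u - T + T * stepInt 1, v - T / 2, w + s * T, T, by nlinarith, by linarith, ?_⟩
  refine reach_ramp hK _ _ 1 0 0 0 0 hT₀ (by simp) (by simp) (by simp) (by ring)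
    (by ring) (by ring) fun y S q q₁ q₂ hy₀ hy₁ hS₀ hS hq₀ hq hq₁₀ hq₁ hq₂ => ?_
  have e1 : m * (1 / T * q₁) ≤ 1 / 2 := by
    rw [one_div_mul_eq_div, mul_div_assoc', div_le_iff₀ hT₀, hTdef]
    nlinarith
  have e2 : 1 / T * q₁ ≤ 1 := by
    rw [one_div_mul_eq_div, div_le_iff₀ hT₀, hTdef]
    nlinarith
  have e3 : T * S ≤ T * y := mul_le_mul_of_nonneg_left hS hT₀.le
  have e4 : 0 ≤ T * y := mul_nonneg hT₀.le hy₀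
  have e5 : 0 ≤ m * (q * (1 - q)) := mul_nonneg (by linarith) (mul_nonneg hq₀ (by linarith))
  refine curvCond_of_le hm hn hκ ?_ ?_ ?_ ?_ ?_ ?_ ?_ ?_ ?_ ?_ <;>
    simp only [zero_mul, add_zero, zero_add, zero_div, one_mul] <;> try linarith
  nlinarith

/-- The second sphere becomes conical again. -/
theorem exists_reach_raise_second (hK : StepBound K) (hm : 2 ≤ m) (hn : 2 ≤ n)
    (hκ : 4 * (m + n + 5) ≤ Real.exp (-2 * κ)) {u v s : ℝ} (hu : u ≤ κ) (hv : v ≤ κ)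
    (hs₀ : 0 < s) (hs : s ≤ 1 / 4) (w : ℝ) : ∃ v' w' T, v' ≤ κ ∧
      Reach m n ⟨u, v, w, 0, -(1 / 2), s⟩ ⟨u, v', w', 0, 0, s⟩ T := by
  have hK₁ := hK.1
  obtain ⟨T, hT₀, hTdef⟩ : ∃ T : ℝ, 0 < T ∧ T * s = n * K := ⟨n * K / s, by positivity, by field_simp⟩
  have S₁ := stepInt_nonneg (y := 1) zero_le_one
  have S₂ := stepInt_le (y := 1) zero_le_one
  refine ⟨v - T / 2 + T / 2 * stepInt 1, w + s * T, T, by nlinarith, ?_⟩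
  refine reach_ramp hK _ _ 0 (1 / 2) 0 0 0 hT₀ (by simp) (by norm_num) (by simp) (by ring)
    (by ring) (by ring) fun y S q q₁ q₂ hy₀ hy₁ hS₀ hS hq₀ hq hq₁₀ hq₁ hq₂ => ?_
  have e1 : n * (1 / 2 / T * q₁) ≤ s / 2 := by
    rw [div_div, one_div_mul_eq_div, mul_div_assoc', div_le_iff₀ (by positivity)]
    nlinarith
  have e0 : 0 ≤ 1 / 2 / T * q₁ := by positivity
  have e2 : 1 / 2 / T * q₁ ≤ 1 := by nlinarith
  have e3 : T * S ≤ T * y := mul_le_mul_of_nonneg_left hS hT₀.le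
  have e5 : 0 ≤ n * ((1 - q) * (1 + q)) :=
    mul_nonneg (by linarith) (mul_nonneg (by linarith) (by linarith))
  refine curvCond_of_le hm hn hκ ?_ ?_ ?_ ?_ ?_ ?_ ?_ ?_ ?_ ?_ <;>
    simp only [zero_mul, add_zero, zero_add, zero_div] <;> try linarith
  nlinarith

/-- Both cone angles are brought back, slowly, to the common value `e^κ`. -/
theorem exists_reach_cone (hK : StepBound K) (hm : 2 ≤ m) (hn : 2 ≤ n)
    (hκ : 4 * (m + n + 5) ≤ Real.exp (-2 * κ)) {u v s : ℝ} (hu : u ≤ κ) (hv : v ≤ κ)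
    (hs₀ : 0 < s) (hs : s ≤ 1 / 4) (w : ℝ) : ∃ w' T,
      Reach m n ⟨u, v, w, 0, 0, s⟩ ⟨κ, κ, w', 0, 0, s⟩ T := by
  have hK₁ := hK.1
  -- the slopes stay below `η` when the time `T` is long
  obtain ⟨η, hη₀, hη, hηs⟩ : ∃ η : ℝ, 0 < η ∧ η ≤ 1 / 4 ∧ 3 * (m + n) * η ≤ s := by
    refine ⟨min (1 / 4) (s / (3 * (m + n))), lt_min (by norm_num) (by positivity),
      min_le_left _ _, ?_⟩
    rw [mul_comm, ← le_div_iff₀ (by linarith)]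
    exact min_le_right _ _
  obtain ⟨T, hT₁, hTu, hTv⟩ : ∃ T : ℝ, 1 ≤ T ∧ (κ - u) * K ≤ η * T ∧ (κ - v) * K ≤ η * T := by
    refine ⟨max 1 (max ((κ - u) * K / η) ((κ - v) * K / η)), le_max_left _ _, ?_, ?_⟩
    · rw [mul_comm η, ← div_le_iff₀ hη₀]
      exact (le_max_left _ _).trans (le_max_right _ _)
    · rw [mul_comm η, ← div_le_iff₀ hη₀]
      exact (le_max_right _ _).trans (le_max_right _ _)
  have hT₀ : 0 < T := by linarith
  refine ⟨w + s * T, T, ?_⟩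
  refine reach_ramp hK _ _ 0 0 0 (κ - u) (κ - v) hT₀ (by simp) (by simp) (by simp) (by ring)
    (by ring) (by ring) fun y S q q₁ q₂ hy₀ hy₁ hS₀ hS hq₀ hq hq₁₀ hq₁ hq₂ => ?_
  have key : ∀ z, 0 ≤ z → z * K ≤ η * T →
      0 ≤ z / T * q₁ ∧ z / T * q₁ ≤ η ∧ z / T ^ 2 * q₂ ≤ η := by
    intro z hz hzT
    refine ⟨by positivity, ?_, ?_⟩
    · rw [div_mul_eq_mul_div, div_le_iff₀ hT₀]
      exact (mul_le_mul_of_nonneg_left hq₁ hz).trans hzT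
    · rw [div_mul_eq_mul_div, div_le_iff₀ (pow_pos hT₀ 2)]
      refine (mul_le_mul_of_nonneg_left ((le_abs_self _).trans hq₂) hz).trans (hzT.trans ?_)
      exact mul_le_mul_of_nonneg_left (by nlinarith) hη₀.le
  obtain ⟨a₀, a₁, a₂⟩ := key (κ - u) (by linarith) hTu
  obtain ⟨b₀, b₁, b₂⟩ := key (κ - v) (by linarith) hTv
  have hu' : (κ - u) * q ≤ κ - u := mul_le_of_le_one_right (by linarith) hq
  have hv' : (κ - v) * q ≤ κ - v := mul_le_of_le_one_right (by linarith) hq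
  set a := (κ - u) / T * q₁
  set b := (κ - v) / T * q₁
  set a' := (κ - u) / T ^ 2 * q₂
  set b' := (κ - v) / T ^ 2 * q₂
  have e1 : m * (a' + a + a ^ 2) ≤ m * (3 * η) :=
    mul_le_mul_of_nonneg_left (by nlinarith) (by linarith)
  have e2 : n * (b' + b + b ^ 2) ≤ n * (3 * η) :=
    mul_le_mul_of_nonneg_left (by nlinarith) (by linarith)
  refine curvCond_of_le hm hn hκ ?_ ?_ ?_ ?_ ?_ ?_ ?_ ?_ ?_ ?_ <;>
    simp only [zero_mul, add_zero, zero_add, zero_div] <;> try linarith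
  nlinarith

/-- The radius of the last factor becomes constant, which costs nothing. -/
theorem reach_lower_third (hK : StepBound K) (hm : 2 ≤ m) (hn : 2 ≤ n)
    (hκ : 4 * (m + n + 5) ≤ Real.exp (-2 * κ)) {s : ℝ}
    (hs₀ : 0 < s) (hs : s ≤ 1 / 4) (w : ℝ) : ∃ w',
      Reach m n ⟨κ, κ, w, 0, 0, s⟩ ⟨κ, κ, w', 0, 0, 0⟩ 1 := by
  refine ⟨w + s + -s * stepInt 1, ?_⟩
  refine reach_ramp hK _ _ 0 0 (-s) 0 0 one_pos (by simp) (by simp) (by simp) (by ring)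
    (by ring) (by ring) fun y S q q₁ q₂ hy₀ hy₁ hS₀ hS hq₀ hq hq₁₀ hq₁ hq₂ => ?_
  have e1 : 0 ≤ s * q₁ := mul_nonneg hs₀.le hq₁₀
  have e2 : 0 ≤ s * (1 - q) := mul_nonneg hs₀.le (by linarith)
  have e3 : 0 ≤ s * q := mul_nonneg hs₀.le hq₀
  have e4 : s * (1 - q) * (1 - s * (1 - q)) ≥ 0 := mul_nonneg e2 (by linarith)
  refine curvCond_of_le hm hn hκ ?_ ?_ ?_ ?_ ?_ ?_ ?_ ?_ ?_ ?_ <;> norm_num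
  · linarith
  · nlinarith

/-- From a constant first and a conical second sphere back to the cone, with a growing radius of the
last factor paying for the convexity of the other two. -/
theorem exists_reach_return (hK : StepBound K) (hm : 2 ≤ m) (hn : 2 ≤ n)
    (hκ : 4 * (m + n + 5) ≤ Real.exp (-2 * κ)) {u μ : ℝ} (hu : u ≤ κ) (hμ : μ < 0) (w : ℝ) :
    ∃ w' T, Reach m n ⟨u, μ, w, -1, 0, 0⟩ ⟨κ, κ, w', 0, 0, 0⟩ T := by
  have hK₁ := hK.1
  have hK₀ : 0 < K := by linarith
  obtain ⟨s, hs₀, hsK⟩ : ∃ s : ℝ, 0 < s ∧ s * K = 1 / 4 :=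
    ⟨1 / (4 * K), by positivity, by field_simp⟩
  have hs : s ≤ 1 / 4 := by nlinarith
  obtain ⟨v₁, hv₁, R₁⟩ := reach_lower_second hK hm hn (u := u) hμ w
  obtain ⟨u₂, T₂, v₂, hu₂, hv₂, R₂⟩ := exists_reach_wait_second hK hm hn (u := u - 1) (v := v₁)
    (κ := κ) (by linarith) (by linarith) w
  obtain ⟨u₃, v₃, w₃, hu₃, hv₃, R₃⟩ := reach_raise_third hK hm hn hκ hu₂ hv₂ hs₀.le hsK.le w
  obtain ⟨u₄, v₄, w₄, T₄, hu₄, hv₄, R₄⟩ := exists_reach_raise_first hK hm hn hκ hu₃ hv₃ hs₀.le hs w₃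
  obtain ⟨v₅, w₅, T₅, hv₅, R₅⟩ := exists_reach_raise_second hK hm hn hκ hu₄ hv₄ hs₀ hs w₄
  obtain ⟨w₆, T₆, R₆⟩ := exists_reach_cone hK hm hn hκ hu₄ hv₅ hs₀ hs w₅
  obtain ⟨w₇, R₇⟩ := reach_lower_third hK hm hn hκ hs₀ hs w₆
  exact ⟨_, _, (((((R₁.trans R₂).trans R₃).trans R₄).trans R₅).trans R₆).trans R₇⟩

end Return

/-! ### The complete profile and its curvature -/

section Profile

variable {m n κ K : ℝ}

theorem path_affine (X : State) {T : ℝ} (hT : 0 < T)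
    (h : ∀ t ∈ Icc 0 T, CurvCond m n (X.u + X.a * t) (X.v + X.b * t) X.a X.b X.s 0 0 0) :
    Path m n X ⟨X.u + X.a * T, X.v + X.b * T, X.w + X.s * T, X.a, X.b, X.s⟩ T
      (fun t => X.u + X.a * t) (fun t => X.v + X.b * t) (fun t => X.w + X.s * t) where
  pos := hT
  smooth := ⟨by fun_prop, by fun_prop, by fun_prop⟩
  before t _ := ⟨rfl, rfl, rfl⟩
  after t _ := ⟨by ring, by ring, by ring⟩
  cond t ht := by
    have D : ∀ p q : ℝ, deriv (fun t : ℝ => p + q * t) = fun _ => q := fun p q => by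
      funext t
      simp
    unfold CurvAt
    rw [D, D, D, deriv_const', deriv_const', deriv_const']
    exact h t ht

theorem curvCond_cone (hm : 2 ≤ m) (hn : 2 ≤ n) (hκ : 4 * (m + n + 5) ≤ Real.exp (-2 * κ)) :
    CurvCond m n κ κ 0 0 0 0 0 0 :=
  curvCond_of_le hm hn hκ le_rfl le_rfl (by norm_num) (by norm_num) (by norm_num) (by norm_num)
    (by norm_num) (by norm_num) (by norm_num) (by norm_num)

/-- From the cone back to the cone, keeping for a time `ℓ` the first sphere at a constant radius and
the second one at the radius `e^μ r`. -/
theorem exists_path_block (hK : StepBound K) (hm : 2 ≤ m) (hn : 2 ≤ n)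
    (hκ : 4 * (m + n + 5) ≤ Real.exp (-2 * κ)) (hκ₀ : κ < 0) {μ ℓ : ℝ} (hμ : μ < 0) (hℓ : 0 < ℓ)
    (w : ℝ) : ∃ u w' T₀, u ≤ κ ∧ ∀ T, T₀ < T → ∃ U V W : ℝ → ℝ,
      Path m n ⟨κ, κ, w, 0, 0, 0⟩ ⟨κ, κ, w', 0, 0, 0⟩ (T + (ℓ + T)) U V W ∧
      ∀ t ∈ Icc T (T + ℓ), U t = u - (t - T) ∧ V t = μ ∧ W t = w := by
  obtain ⟨u, T₁, hu, hT₁, R₁⟩ := exists_reach_split hK hm hn hκ hκ₀ hμ w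
  obtain ⟨w', T₂, R₂⟩ := exists_reach_return hK hm hn hκ (u := u - ℓ) (by linarith) hμ w
  refine ⟨u, w', max T₁ T₂, hu, fun T hT => ?_⟩
  have hT₁' : 0 < T - T₁ := by linarith [le_max_left T₁ T₂]
  have hT₂' : 0 < T - T₂ := by linarith [le_max_right T₁ T₂]
  have A₁ := (reach_wait_cone hK hm hn hκ w hT₁').trans R₁
  have A₂ := R₂.trans (reach_wait_cone hK hm hn hκ w' hT₂')
  rw [sub_add_cancel] at A₁
  rw [add_sub_cancel] at A₂
  obtain ⟨u₁, v₁, w₁, P₁⟩ := A₁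
  obtain ⟨u₂, v₂, w₂, P₂⟩ := A₂
  have Q := path_affine (m := m) (n := n) ⟨u, μ, w, -1, 0, 0⟩ hℓ (fun t _ => by
    have e1 : 1 ≤ Real.exp (-2 * μ) := Real.one_le_exp (by linarith)
    have e2 := mul_le_mul_of_nonneg_left e1 (show 0 ≤ n - 1 by linarith)
    refine ⟨by norm_num, ?_, ?_⟩
    · norm_num
      exact mul_nonneg (by linarith) (Real.exp_pos _).le
    · norm_num at e2 ⊢
      linarith)
  have hQ : (⟨u + -1 * ℓ, μ + 0 * ℓ, w + 0 * ℓ, -1, 0, 0⟩ : State) = ⟨u - ℓ, μ, w, -1, 0, 0⟩ := by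
    ext <;> simp
    ring
  simp only [hQ] at Q
  obtain ⟨u₃, v₃, w₃, P₃, h₃, -⟩ := Q.trans P₂
  obtain ⟨U, V, W, P, -, h⟩ := P₁.trans P₃
  refine ⟨U, V, W, P, fun t ht => ?_⟩
  obtain ⟨hU, hV, hW⟩ := h t ht.1
  obtain ⟨hu₃, hv₃, hw₃⟩ := h₃ (t - T) (by linarith [ht.2])
  exact ⟨by rw [hU, hu₃]; ring, by rw [hV, hv₃]; ring, by rw [hW, hw₃]; ring⟩

/-- The exponents of the three warping functions, as functions of `log r` up to a translation. -/
theorem exists_profile (hm : 2 ≤ m) (hn : 2 ≤ n)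
    (hκ : 4 * (m + n + 5) ≤ Real.exp (-2 * κ)) (hκ₀ : κ < 0) {μ ℓ d : ℝ} (hμ : μ < 0) (hℓ : 0 < ℓ)
    (hd : 0 < d) : ∃ T u₁ u₂ w₁ w₂, 0 < T ∧ u₁ ≤ κ ∧ u₂ ≤ κ ∧ ∃ U V W : ℝ → ℝ,
      Path m n ⟨κ, κ, 0, 0, 0, 0⟩ ⟨κ, κ, w₂, 0, 0, 0⟩ (4 * T + 2 * ℓ + d) U V W ∧
      (∀ t ∈ Icc T (T + ℓ), U t = u₁ - (t - T) ∧ V t = μ ∧ W t = 0) ∧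
      (∀ t ∈ Icc (2 * T + ℓ) (2 * T + ℓ + d), U t = κ ∧ V t = κ ∧ W t = w₁) ∧
      (∀ t ∈ Icc (3 * T + ℓ + d) (3 * T + 2 * ℓ + d),
        U t = μ ∧ V t = u₂ - (t - (3 * T + ℓ + d)) ∧ W t = w₁) := by
  obtain ⟨K, hK⟩ := exists_bound_smoothTransition
  have hκ' : 4 * (n + m + 5) ≤ Real.exp (-2 * κ) := by linarith
  obtain ⟨u₁, w₁, T₁, hu₁, H₁⟩ := exists_path_block hK hm hn hκ hκ₀ hμ hℓ 0
  obtain ⟨u₂, w₂, T₂, hu₂, H₂⟩ := exists_path_block hK hn hm hκ' hκ₀ hμ hℓ w₁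
  obtain ⟨T, hT₀, hT₁, hT₂⟩ : ∃ T, 0 < T ∧ T₁ < T ∧ T₂ < T :=
    ⟨max 0 (max T₁ T₂) + 1, by linarith [le_max_left 0 (max T₁ T₂)],
      by linarith [le_max_right 0 (max T₁ T₂), le_max_left T₁ T₂],
      by linarith [le_max_right 0 (max T₁ T₂), le_max_right T₁ T₂]⟩
  obtain ⟨U₁, V₁, W₁, P₁, F₁⟩ := H₁ T hT₁
  obtain ⟨V₂, U₂, W₂, P₂, F₂⟩ := H₂ T hT₂
  have Q := path_affine (m := m) (n := n) ⟨κ, κ, w₁, 0, 0, 0⟩ hd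
    (fun t _ => by simpa using curvCond_cone hm hn hκ)
  simp only [zero_mul, add_zero] at Q
  obtain ⟨U₃, V₃, W₃, P₃, E₃, G₃⟩ := Q.trans P₂.swap
  obtain ⟨U, V, W, P, E, G⟩ := P₁.trans P₃
  refine ⟨T, u₁, u₂, w₁, w₂, hT₀, hu₁, hu₂, U, V, W, ?_, fun t ht => ?_, fun t ht => ?_,
    fun t ht => ?_⟩
  · convert P using 1
    ring
  · obtain ⟨hU, hV, hW⟩ := E t (by linarith [ht.2])
    rw [hU, hV, hW]
    exact F₁ t ht
  · obtain ⟨hU, hV, hW⟩ := G t (by linarith [ht.1])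
    rw [hU, hV, hW]
    exact E₃ _ (by linarith [ht.2])
  · obtain ⟨hU, hV, hW⟩ := G t (by linarith [ht.1])
    obtain ⟨hU', hV', hW'⟩ := G₃ (t - (T + (ℓ + T))) (by linarith [ht.1])
    obtain ⟨f₁, f₂, f₃⟩ := F₂ (t - (T + (ℓ + T)) - d)
      ⟨by linarith [ht.1], by linarith [ht.2]⟩
    rw [hU, hV, hW, hU', hV', hW']
    exact ⟨f₂, by rw [f₁]; ring, f₃⟩

/-- Outside the time interval of the path the metric is the cone, so that the curvature conditions
hold at all times. -/
theorem curvAt_of_path {w w' T : ℝ} {U V W : ℝ → ℝ} (hc : CurvCond m n κ κ 0 0 0 0 0 0)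
    (P : Path m n ⟨κ, κ, w, 0, 0, 0⟩ ⟨κ, κ, w', 0, 0, 0⟩ T U V W) (t : ℝ) :
    CurvAt m n U V W t := by
  have C : ∀ x : ℝ, CurvAt m n (fun _ => κ) (fun _ => κ) (fun _ => x) t := fun x => by
    simpa [CurvAt] using hc
  rcases lt_or_ge t 0 with h | h
  · have hn : ∀ᶠ x in 𝓝 t, x ≤ 0 := Filter.Eventually.mono (Iio_mem_nhds h) fun x hx => le_of_lt hx
    refine (C w).congr (hn.mono fun x hx => ?_) (hn.mono fun x hx => ?_) (hn.mono fun x hx => ?_)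
    · simpa using (P.before x hx).1
    · simpa using (P.before x hx).2.1
    · simpa using (P.before x hx).2.2
  rcases le_or_gt t T with h' | h'
  · exact P.cond t ⟨h, h'⟩
  · have hn : ∀ᶠ x in 𝓝 t, T ≤ x := Filter.Eventually.mono (Ioi_mem_nhds h') fun x hx => le_of_lt hx
    refine (C w').congr (hn.mono fun x hx => ?_) (hn.mono fun x hx => ?_) (hn.mono fun x hx => ?_)
    · simpa using (P.after x hx).1
    · simpa using (P.after x hx).2.1
    · simpa using (P.after x hx).2.2

theorem deriv_eq_zero_of_path {w w' T : ℝ} {U V W : ℝ → ℝ}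
    (P : Path m n ⟨κ, κ, w, 0, 0, 0⟩ ⟨κ, κ, w', 0, 0, 0⟩ T U V W) {t : ℝ} (ht : t ∉ Icc 0 T) :
    deriv W t = 0 ∧ deriv (deriv W) t = 0 := by
  have C : ∀ x : ℝ, W =ᶠ[𝓝 t] (fun _ => x) → deriv W t = 0 ∧ deriv (deriv W) t = 0 := fun x hx =>
    ⟨by rw [hx.deriv_eq]; simp, by rw [hx.deriv.deriv_eq]; simp⟩
  rcases lt_or_ge t 0 with h | h
  · have hn : ∀ᶠ x in 𝓝 t, x ≤ 0 := Filter.Eventually.mono (Iio_mem_nhds h) fun x hx => le_of_lt hx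
    exact C w (hn.mono fun x hx => by simpa using (P.before x hx).2.2)
  · have h' : T < t := lt_of_not_ge fun h' => ht ⟨h, h'⟩
    have hn : ∀ᶠ x in 𝓝 t, T ≤ x := Filter.Eventually.mono (Ioi_mem_nhds h') fun x hx => le_of_lt hx
    exact C w' (hn.mono fun x hx => by simpa using (P.after x hx).2.2)

/-- For small `l` the curvature of the round metric on the last factor, which is of size `l⁻²`,
dominates all the other terms; it is only needed on the compact interval on which `W` varies. -/
theorem exists_scale {w w' T c : ℝ} {U V W : ℝ → ℝ}
    (P : Path m n ⟨κ, κ, w, 0, 0, 0⟩ ⟨κ, κ, w', 0, 0, 0⟩ T U V W) :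
    ∃ l, 0 < l ∧ ∀ t, (l * Real.exp (W t)) ^ 2 * Real.exp (-2 * (t + c)) *
      (deriv (deriv W) t - deriv W t + 2 * deriv W t ^ 2
        + deriv W t * (m * (1 + deriv U t) + n * (1 + deriv V t))) ≤ 1 := by
  obtain ⟨hU, hV, hW⟩ := P.smooth
  have c1 := (contDiff_deriv_of_contDiff hU).continuous
  have d1 := (contDiff_deriv_of_contDiff hV).continuous
  have e0 := hW.continuous
  have e1 := (contDiff_deriv_of_contDiff hW).continuous
  have e2 := (contDiff_deriv_of_contDiff (contDiff_deriv_of_contDiff hW)).continuous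
  obtain ⟨M, hM⟩ := (isCompact_Icc (a := (0 : ℝ)) (b := T)).exists_bound_of_continuousOn
    (f := fun t => Real.exp (W t) ^ 2 * Real.exp (-2 * (t + c)) *
      (deriv (deriv W) t - deriv W t + 2 * deriv W t ^ 2
        + deriv W t * (m * (1 + deriv U t) + n * (1 + deriv V t)))) (by fun_prop)
  have hl : 0 < (|M| + 1)⁻¹ := by positivity
  refine ⟨(|M| + 1)⁻¹, hl, fun t => ?_⟩
  by_cases ht : t ∈ Icc 0 T
  · have h1 := (le_abs_self _).trans ((hM t ht).trans (le_abs_self M))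
    rw [mul_pow, mul_assoc, mul_assoc]
    rw [mul_assoc] at h1
    have h2 : (|M| + 1)⁻¹ ^ 2 * |M| ≤ 1 := by
      rw [inv_pow, inv_mul_le_iff₀ (by positivity)]
      nlinarith [abs_nonneg M]
    exact (mul_le_mul_of_nonneg_left h1 (by positivity)).trans h2
  · obtain ⟨h1, h2⟩ := deriv_eq_zero_of_path P ht
    simp [h1, h2]

end Profile

section LogCoordinate

variable {U : ℝ → ℝ} {c l : ℝ}

theorem hasDerivAt_comp_log {f : ℝ → ℝ} (hf : Differentiable ℝ f) {r : ℝ} (hr : 0 < r) :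
    HasDerivAt (fun r => f (Real.log r - c)) (deriv f (Real.log r - c) / r) r := by
  have h := (hf (Real.log r - c)).hasDerivAt.comp r ((Real.hasDerivAt_log hr.ne').sub_const c)
  exact h.congr_deriv (by rw [div_eq_mul_inv])

theorem deriv_deriv_eq_of_pos {f g : ℝ → ℝ} {d r : ℝ} (h : ∀ x, 0 < x → HasDerivAt f (g x) x)
    (hr : 0 < r) (hg : HasDerivAt g d r) : deriv (deriv f) r = d := by
  have h1 : deriv f =ᶠ[𝓝 r] g :=
    Filter.Eventually.mono (Ioi_mem_nhds hr) fun x hx => (h x hx).deriv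
  rw [h1.deriv_eq, hg.deriv]

/-- The warping function `r e^{U(log r - c)}` and its first two derivatives. -/
theorem deriv_cone (hU : ContDiff ℝ ∞ U) {r : ℝ} (hr : 0 < r) :
    deriv (fun r => r * Real.exp (U (Real.log r - c))) r =
      Real.exp (U (Real.log r - c)) * (1 + deriv U (Real.log r - c)) ∧
    deriv (deriv (fun r => r * Real.exp (U (Real.log r - c)))) r =
      Real.exp (U (Real.log r - c)) / r * (deriv (deriv U) (Real.log r - c)
        + deriv U (Real.log r - c) + deriv U (Real.log r - c) ^ 2) := by
  have dU : Differentiable ℝ U := hU.differentiable (by norm_num)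
  have dU' : Differentiable ℝ (deriv U) :=
    (contDiff_deriv_of_contDiff hU).differentiable (by norm_num)
  have h1 : ∀ x, 0 < x → HasDerivAt (fun r => r * Real.exp (U (Real.log r - c)))
      (Real.exp (U (Real.log x - c)) * (1 + deriv U (Real.log x - c))) x := fun x hx => by
    refine ((hasDerivAt_id x).mul (hasDerivAt_comp_log dU hx).exp).congr_deriv ?_
    simp only [id]
    field_simp
  refine ⟨(h1 r hr).deriv, deriv_deriv_eq_of_pos h1 hr ?_⟩
  refine ((hasDerivAt_comp_log dU hr).exp.mul ((hasDerivAt_comp_log dU' hr).const_add 1)).congr_deriv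
    ?_
  field_simp
  ring

/-- The warping function `l e^{W(log r - c)}` and its first two derivatives. -/
theorem deriv_scaled (hU : ContDiff ℝ ∞ U) {r : ℝ} (hr : 0 < r) :
    deriv (fun r => l * Real.exp (U (Real.log r - c))) r =
      l * Real.exp (U (Real.log r - c)) * deriv U (Real.log r - c) / r ∧
    deriv (deriv (fun r => l * Real.exp (U (Real.log r - c)))) r =
      l * Real.exp (U (Real.log r - c)) / r ^ 2 * (deriv (deriv U) (Real.log r - c)
        - deriv U (Real.log r - c) + deriv U (Real.log r - c) ^ 2) := by
  have dU : Differentiable ℝ U := hU.differentiable (by norm_num)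
  have dU' : Differentiable ℝ (deriv U) :=
    (contDiff_deriv_of_contDiff hU).differentiable (by norm_num)
  have h1 : ∀ x, 0 < x → HasDerivAt (fun r => l * Real.exp (U (Real.log r - c)))
      (l * Real.exp (U (Real.log x - c)) * deriv U (Real.log x - c) / x) x := fun x hx => by
    refine ((hasDerivAt_comp_log dU hx).exp.const_mul l).congr_deriv ?_
    field_simp
  refine ⟨(h1 r hr).deriv, deriv_deriv_eq_of_pos h1 hr ?_⟩
  refine ((((hasDerivAt_comp_log dU hr).exp.const_mul l).mul (hasDerivAt_comp_log dU' hr)).div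
    (hasDerivAt_id r) hr.ne').congr_deriv ?_
  simp only [id, Pi.mul_apply]
  field_simp
  ring

theorem contDiffOn_comp_log (hU : ContDiff ℝ ∞ U) :
    ContDiffOn ℝ ∞ (fun r => Real.exp (U (Real.log r - c))) (Ioi 0) :=
  Real.contDiff_exp.comp_contDiffOn (hU.comp_contDiffOn
    ((Real.contDiffOn_log.mono fun _ hx => ne_of_gt hx).sub contDiffOn_const))

theorem smoothPos_cone (hU : ContDiff ℝ ∞ U) :
    SmoothPos (fun r => r * Real.exp (U (Real.log r - c))) :=
  ⟨contDiffOn_id.mul (contDiffOn_comp_log hU), fun _ hr => mul_pos hr (Real.exp_pos _)⟩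

theorem smoothPos_scaled (hU : ContDiff ℝ ∞ U) (hl : 0 < l) :
    SmoothPos (fun r => l * Real.exp (U (Real.log r - c))) :=
  ⟨contDiffOn_const.mul (contDiffOn_comp_log hU), fun _ _ => mul_pos hl (Real.exp_pos _)⟩

theorem ricciNonnegOn_of_curvAt {m n : ℕ} {U V W : ℝ → ℝ} (hU : ContDiff ℝ ∞ U)
    (hV : ContDiff ℝ ∞ V) (hW : ContDiff ℝ ∞ W) (hl : 0 < l) (h : ∀ t, CurvAt m n U V W t)
    (hs : ∀ t, (l * Real.exp (W t)) ^ 2 * Real.exp (-2 * (t + c)) *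
      (deriv (deriv W) t - deriv W t + 2 * deriv W t ^ 2
        + deriv W t * (m * (1 + deriv U t) + n * (1 + deriv V t))) ≤ 1) :
    RicciNonnegOn (totalModel m n) (warpedMetric m n
      (fun r => r * Real.exp (U (Real.log r - c))) (fun r => r * Real.exp (V (Real.log r - c)))
      (fun r => l * Real.exp (W (Real.log r - c)))) {p | 0 < p.1} := by
  refine ricciNonnegOn_warpedMetric (smoothPos_cone hU) (smoothPos_cone hV) (smoothPos_scaled hW hl)
    (fun r hr => ?_) (fun r hr => ?_) (fun r hr => ?_) (fun r hr => ?_)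
  all_goals
    obtain ⟨u1, u2⟩ := deriv_cone (c := c) hU hr
    obtain ⟨v1, v2⟩ := deriv_cone (c := c) hV hr
    obtain ⟨w1, w2⟩ := deriv_scaled (c := c) (l := l) hW hr
    obtain ⟨h1, h2, h3⟩ := h (Real.log r - c)
    have h4 := hs (Real.log r - c)
    have hexp : ∀ x, Real.exp (-2 * x) = (Real.exp x ^ 2)⁻¹ := fun x => by
      rw [← Real.exp_nat_mul, ← Real.exp_neg]; congr 1; push_cast; ring
    rw [hexp] at h2 h3 h4
    rw [sub_add_cancel, Real.exp_log hr] at h4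
    simp only [u1, v1, w1, u2, v2, w2]
    have pu := Real.exp_pos (U (Real.log r - c))
    have pv := Real.exp_pos (V (Real.log r - c))
    have pw := Real.exp_pos (W (Real.log r - c))
    clear u1 v1 w1 u2 v2 w2 hexp
    generalize Real.exp (U (Real.log r - c)) = x at *
    generalize Real.exp (V (Real.log r - c)) = y at *
    generalize Real.exp (W (Real.log r - c)) = z at *
    generalize deriv (deriv U) (Real.log r - c) = a' at *
    generalize deriv (deriv V) (Real.log r - c) = b' at *
    generalize deriv (deriv W) (Real.log r - c) = s' at *
    generalize deriv U (Real.log r - c) = a at *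
    generalize deriv V (Real.log r - c) = b at *
    generalize deriv W (Real.log r - c) = s at *
  · have e : (m : ℝ) * (x / r * (a' + a + a ^ 2) / (r * x))
        + n * (y / r * (b' + b + b ^ 2) / (r * y))
        + 2 * (l * z / r ^ 2 * (s' - s + s ^ 2) / (l * z)) =
        (m * (a' + a + a ^ 2) + n * (b' + b + b ^ 2) + 2 * (s' - s + s ^ 2)) / r ^ 2 := by
      field_simp
    rw [e]
    exact div_nonpos_of_nonpos_of_nonneg h1 (sq_nonneg r)
  · have e : factorRicci m (r * x) (x * (1 + a)) (x / r * (a' + a + a ^ 2))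
        (n * (y * (1 + b) / (r * y)) + 2 * (l * z * s / r / (l * z))) =
        x ^ 2 * ((m - 1) * (x ^ 2)⁻¹
          - (a' + (1 + a) * (m * (1 + a) + n * (1 + b) + 2 * s - 1))) := by
      unfold factorRicci
      field_simp
      ring
    rw [e]
    exact mul_nonneg (sq_nonneg x) (sub_nonneg.2 h2)
  · have e : factorRicci n (r * y) (y * (1 + b)) (y / r * (b' + b + b ^ 2))
        (m * (x * (1 + a) / (r * x)) + 2 * (l * z * s / r / (l * z))) =
        y ^ 2 * ((n - 1) * (y ^ 2)⁻¹
          - (b' + (1 + b) * (m * (1 + a) + n * (1 + b) + 2 * s - 1))) := by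
      unfold factorRicci
      field_simp
      ring
    rw [e]
    exact mul_nonneg (sq_nonneg y) (sub_nonneg.2 h3)
  · have e : factorRicci 2 (l * z) (l * z * s / r) (l * z / r ^ 2 * (s' - s + s ^ 2))
        (m * (x * (1 + a) / (r * x)) + n * (y * (1 + b) / (r * y))) =
        1 - (l * z) ^ 2 * (r ^ 2)⁻¹ *
          (s' - s + 2 * s ^ 2 + s * (m * (1 + a) + n * (1 + b))) := by
      unfold factorRicci
      field_simp
      ring
    rw [e]
    exact sub_nonneg.2 h4

end LogCoordinate

end TripleWarped

theorem proposition4p2 :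
    ∀ m n : ℕ, 2 ≤ m → 2 ≤ n →
    ∃ k : ℝ, 0 < k ∧
    ∀ ε : ℝ, 0 < ε → ε < 1 →
    ∃ c : ℝ, 0 < c ∧
    ∀ L : ℝ, 1 < L →
    ∃ R : ℝ, 1 < R ∧
    ∃ (δ₁ δ₂ l₁ l₂ l₃ : ℝ) (φ ψ ρ : ℝ → ℝ),
      0 < δ₁ ∧ δ₁ < c * (L ^ 2 * R ^ 2)⁻¹ ∧ 0 < δ₂ ∧ δ₂ < c * L⁻¹ ∧
      0 < l₁ ∧ 0 < l₂ ∧ 0 < l₃ ∧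
      TripleWarped.SmoothPos φ ∧ TripleWarped.SmoothPos ψ ∧ TripleWarped.SmoothPos ρ ∧
      (∀ r ∈ Set.Ioo 0 (2 * L ^ 2 * R ^ 3)⁻¹, φ r = k * r ∧ ψ r = k * r ∧ ρ r = l₁) ∧
      (∀ r ∈ Set.Icc (2 * L ^ 2 * R ^ 2)⁻¹ (2 * L * R ^ 2)⁻¹,
        φ r = δ₁ ∧ ψ r = (1 - ε) * r ∧ ρ r = l₁) ∧
      (∀ r ∈ Set.Icc (2 * L * R)⁻¹ (L * R)⁻¹, φ r = k * r ∧ ψ r = k * r ∧ ρ r = l₂) ∧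
      (∀ r ∈ Set.Icc L⁻¹ 1, φ r = (1 - ε) * r ∧ ψ r = δ₂ ∧ ρ r = l₂) ∧
      (∀ r ∈ Set.Ici R, φ r = k * r ∧ ψ r = k * r ∧ ρ r = l₃) ∧
      TripleWarped.RicciNonnegOn (TripleWarped.totalModel m n)
        (TripleWarped.warpedMetric m n φ ψ ρ) {p | 0 < p.1} := by
  intro m n hm hn
  have hm' : (2 : ℝ) ≤ m := by exact_mod_cast hm
  have hn' : (2 : ℝ) ≤ n := by exact_mod_cast hn
  have hk : (0 : ℝ) < (m + n + 5 : ℝ)⁻¹ := by positivity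
  refine ⟨(m + n + 5 : ℝ)⁻¹, hk, fun ε hε₀ hε₁ => ⟨1, one_pos, fun L hL => ?_⟩⟩
  set k : ℝ := (m + n + 5 : ℝ)⁻¹ with hkdef
  set κ := Real.log k with hκdef
  have hkκ : Real.exp κ = k := Real.exp_log hk
  have hκ₀ : κ < 0 := Real.log_neg hk (inv_lt_one_of_one_lt₀ (by linarith))
  have hκ : 4 * ((m : ℝ) + n + 5) ≤ Real.exp (-2 * κ) := by
    have e : Real.exp (-2 * κ) = ((m : ℝ) + n + 5) ^ 2 := by
      have : -2 * κ = -κ + -κ := by ring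
      rw [this, Real.exp_add, Real.exp_neg, hkκ, hkdef, inv_inv, sq]
    rw [e]
    nlinarith
  have hμ : Real.log (1 - ε) < 0 := Real.log_neg (by linarith) (by linarith)
  have hμ' : Real.exp (Real.log (1 - ε)) = 1 - ε := Real.exp_log (by linarith)
  have hℓ : 0 < Real.log L := Real.log_pos hL
  have hd : 0 < Real.log 2 := Real.log_pos (by norm_num)
  obtain ⟨T, u₁, u₂, w₁, w₂, hT, hu₁, hu₂, U, V, W, P, H₁, H₂, H₃⟩ :=
    TripleWarped.exists_profile hm' hn' hκ hκ₀ hμ hℓ hd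
  set μ := Real.log (1 - ε)
  set ℓ := Real.log L with hℓdef
  have hL₀ : 0 < L := by linarith
  have lR : Real.log (Real.exp T) = T := Real.log_exp T
  have hR₀ : 0 < Real.exp T := Real.exp_pos T
  have hR : 1 < Real.exp T := Real.one_lt_exp_iff.2 hT
  refine ⟨Real.exp T, hR, ?_⟩
  generalize Real.exp T = R at *
  -- the instant `t = 0` corresponds to the radius `(2 L² R³)⁻¹`
  obtain ⟨c, hc⟩ : ∃ c, c = -(Real.log 2 + 2 * ℓ + 3 * T) := ⟨_, rfl⟩
  have log₁ : Real.log (2 * L ^ 2 * R ^ 3)⁻¹ = -(Real.log 2 + 2 * ℓ + 3 * T) := by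
    rw [Real.log_inv, Real.log_mul (by positivity) (by positivity),
      Real.log_mul (by positivity) (by positivity), Real.log_pow, Real.log_pow, lR]
    norm_num [← hℓdef]
  have log₂ : Real.log (2 * L ^ 2 * R ^ 2)⁻¹ = -(Real.log 2 + 2 * ℓ + 2 * T) := by
    rw [Real.log_inv, Real.log_mul (by positivity) (by positivity),
      Real.log_mul (by positivity) (by positivity), Real.log_pow, Real.log_pow, lR]
    norm_num [← hℓdef]
  have log₃ : Real.log (2 * L * R ^ 2)⁻¹ = -(Real.log 2 + ℓ + 2 * T) := by
    rw [Real.log_inv, Real.log_mul (by positivity) (by positivity),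
      Real.log_mul (by positivity) (by positivity), Real.log_pow, lR]
    norm_num [← hℓdef]
  have log₄ : Real.log (2 * L * R)⁻¹ = -(Real.log 2 + ℓ + T) := by
    rw [Real.log_inv, Real.log_mul (by positivity) (by positivity),
      Real.log_mul (by positivity) (by positivity), lR]
  have log₅ : Real.log (L * R)⁻¹ = -(ℓ + T) := by
    rw [Real.log_inv, Real.log_mul (by positivity) (by positivity), lR]
  have log₆ : Real.log L⁻¹ = -ℓ := Real.log_inv L
  have logmem : ∀ {a b r : ℝ}, 0 < a → r ∈ Set.Icc a b →
      0 < r ∧ Real.log a ≤ Real.log r ∧ Real.log r ≤ Real.log b := fun ha hr =>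
    ⟨ha.trans_le hr.1, Real.log_le_log ha hr.1, Real.log_le_log (ha.trans_le hr.1) hr.2⟩
  obtain ⟨l, hl, hs⟩ := TripleWarped.exists_scale (c := c) P
  obtain ⟨cU, cV, cW⟩ := P.smooth
  refine ⟨Real.exp (u₁ + T + c), Real.exp (u₂ + (3 * T + ℓ + Real.log 2) + c), l * Real.exp 0,
    l * Real.exp w₁, l * Real.exp w₂, _, _, _, Real.exp_pos _, ?_, Real.exp_pos _, ?_,
    by positivity, by positivity, by positivity, TripleWarped.smoothPos_cone (c := c) cU,
    TripleWarped.smoothPos_cone (c := c) cV, TripleWarped.smoothPos_scaled (c := c) cW hl,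
    fun r hr => ?_, fun r hr => ?_, fun r hr => ?_, fun r hr => ?_, fun r hr => ?_,
    TripleWarped.ricciNonnegOn_of_curvAt cU cV cW hl
      (TripleWarped.curvAt_of_path (TripleWarped.curvCond_cone hm' hn' hκ) P) hs⟩
  · have e : Real.log (L ^ 2 * R ^ 2)⁻¹ = -(2 * ℓ + 2 * T) := by
      rw [Real.log_inv, Real.log_mul (by positivity) (by positivity), Real.log_pow, Real.log_pow, lR]
      norm_num [← hℓdef]
    rw [one_mul, ← Real.exp_log (show 0 < (L ^ 2 * R ^ 2)⁻¹ by positivity), e, Real.exp_lt_exp]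
    linarith
  · rw [one_mul, ← Real.exp_log (show 0 < L⁻¹ by positivity), log₆, Real.exp_lt_exp]
    linarith
  · have h1 : Real.log r < Real.log (2 * L ^ 2 * R ^ 3)⁻¹ := Real.log_lt_log hr.1 hr.2
    obtain ⟨hU, hV, hW⟩ := P.before (Real.log r - c) (by linarith)
    simp only [hU, hV, hW, zero_mul, add_zero, hkκ, mul_comm k r, and_self]
  · obtain ⟨h0, h1, h2⟩ := logmem (by positivity) hr
    obtain ⟨hU, hV, hW⟩ := H₁ (Real.log r - c) ⟨by linarith, by linarith⟩
    have e : u₁ + T + c = Real.log r + (u₁ - (Real.log r - c - T)) := by ring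
    simp only [hU, hV, hW, hμ', mul_comm (1 - ε) r, and_self, e, Real.exp_add (Real.log r),
      Real.exp_log h0]
  · obtain ⟨h0, h1, h2⟩ := logmem (by positivity) hr
    obtain ⟨hU, hV, hW⟩ := H₂ (Real.log r - c) ⟨by linarith, by linarith⟩
    simp only [hU, hV, hW, hkκ, mul_comm k r, and_self]
  · obtain ⟨h0, h1, h2⟩ := logmem (by positivity) hr
    rw [Real.log_one] at h2
    obtain ⟨hU, hV, hW⟩ := H₃ (Real.log r - c) ⟨by linarith, by linarith⟩
    have e : u₂ + (3 * T + ℓ + Real.log 2) + c =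
      Real.log r + (u₂ - (Real.log r - c - (3 * T + ℓ + Real.log 2))) := by ring
    simp only [hU, hV, hW, hμ', mul_comm (1 - ε) r, and_self, e, Real.exp_add (Real.log r),
      Real.exp_log h0]
  · have h1 : Real.log R ≤ Real.log r := Real.log_le_log hR₀ hr
    obtain ⟨hU, hV, hW⟩ := P.after (Real.log r - c) (by linarith)
    simp only [hU, hV, hW, zero_mul, add_zero, hkκ, mul_comm k r, and_self]
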